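/- Let $n\in\mathbb N$, $\sigma\in\mathbb R^{n\times n}$, $a=\sigma\sigma^\top$, let $b:\mathbb R^n\to\mathbb R^n$ and $f:\mathbb R^n\to\mathbb R$ be of class $C^2$, and let $T>0$ and $x\in\mathbb R^n$. Write $\nabla b$ for the Jacobian matrix, $(\nabla b)_{ij}=\partial_j b_i$, write $\nabla\nabla$ for the Hessian, and $A:zz=\sum_{i,j}A_{ij}z_iz_j$. Let $(\phi_x,\theta_x):[0,T]\to\mathbb R^n\times\mathbb R^n$ solve the instanton equations $$\dot\phi_x=a\theta_x+b(\phi_x),\quad \phi_x(0)=x,\qquad \dot\theta_x=-(\nabla b(\phi_x))^\top\theta_x,\quad \theta_x(T)=\nabla f(\phi_x(T)),$$ and let $W_x:[0,T]\to\mathbb R^{n\times n}$ solve on $[0,T]$ the Riccati equation $$\dot W_x=-\nabla\nabla\langle b(\phi_x),\theta_x\rangle-(\nabla b(\phi_x))^\top W_x-W_x\nabla b(\phi_x)-W_xaW_x,\qquad W_x(T)=\nabla\nabla f(\phi_x(T)),$$ where $\nabla\nabla\langle b(\phi_x),\theta_x\rangle$ is the Hessian of $y\mapsto\langle b(y),\theta_x(t)\rangle$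 at $y=\phi_x(t)$, with $\theta_x(t)$ held fixed. Define the prefactor $$R(T,x)=\exp\Big(\tfrac12\int_0^T\mathrm{tr}(aW_x(t))\,dt\Big).$$ Let $Z$ solve, on some probability space with an $n$-dimensional Wiener process $B$, the linear equation $$dZ_t=\nabla b(\phi_x(t))Z_t\,dt+\sigma\,dB_t,\qquad Z_0=0,\qquad 0\le t\le T.$$ Then the random variable inside the following expectation is integrable, and $$R(T,x)=\mathbb E\exp\Big(\tfrac12\int_0^T\nabla\nabla\langle b(\phi_x(t)),\theta_x(t)\rangle:Z_tZ_t\,dt+\tfrac12\nabla\nabla f(\phi_x(T)):Z_TZ_T\Big).$$ -/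

import Mathlib

open MeasureTheory ProbabilityTheory Set
open scoped Matrix NNReal

/-! Vectors of `ℝⁿ` are functions `Fin n → ℝ`; scalar products are `⬝ᵥ`. The norm of the space enters
only through differentiability and continuity, which do not depend on its choice. -/

noncomputable section

/-- The gradient `(∇f(x))ᵢ = ∂ᵢ f(x)`. -/
def gradVec {n : ℕ} (f : (Fin n → ℝ) → ℝ) (x : Fin n → ℝ) : Fin n → ℝ :=
  fun i => fderiv ℝ f x (Pi.single i 1)

/-- The Jacobian matrix `(∇b(x))ᵢⱼ = ∂ⱼ bᵢ(x)` of a vector field. -/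
def jacobianMat {n : ℕ} (b : (Fin n → ℝ) → (Fin n → ℝ)) (x : Fin n → ℝ) :
    Matrix (Fin n) (Fin n) ℝ :=
  Matrix.of fun i j => fderiv ℝ (fun y => b y i) x (Pi.single j 1)

/-- The Hessian matrix `(∇∇f(x))ᵢⱼ = ∂ᵢ ∂ⱼ f(x)`. -/
def hessianMat {n : ℕ} (f : (Fin n → ℝ) → ℝ) (x : Fin n → ℝ) : Matrix (Fin n) (Fin n) ℝ :=
  Matrix.of fun i j => fderiv ℝ (fun y => fderiv ℝ f y (Pi.single j 1)) x (Pi.single i 1)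

/-- `∇∇⟨b(x), θ⟩`: the Hessian at `x` of `y ↦ ⟨b(y), θ⟩`, with the vector `θ` held fixed. -/
def driftHessian {n : ℕ} (b : (Fin n → ℝ) → (Fin n → ℝ)) (x θ : Fin n → ℝ) :
    Matrix (Fin n) (Fin n) ℝ :=
  hessianMat (fun y => b y ⬝ᵥ θ) x

/-- The contraction `A : z z = ∑ᵢⱼ Aᵢⱼ zᵢ zⱼ`. -/
def quadContr {n : ℕ} (A : Matrix (Fin n) (Fin n) ℝ) (z : Fin n → ℝ) : ℝ :=
  ∑ i, ∑ j, A i j * z i * z j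

/-- `(φ, θ)` solves the instanton equations on `[0, T]`,
`φ' = a θ + b(φ)`, `φ(0) = x`, and `θ' = -(∇b(φ))ᵀ θ`, `θ(T) = ∇f(φ(T))`
(one-sided derivatives at the end points). -/
structure IsInstanton {n : ℕ} (a : Matrix (Fin n) (Fin n) ℝ) (b : (Fin n → ℝ) → (Fin n → ℝ))
    (f : (Fin n → ℝ) → ℝ) (T : ℝ) (x : Fin n → ℝ) (φ θ : ℝ → (Fin n → ℝ)) : Prop where
  deriv_path : ∀ t ∈ Icc 0 T, HasDerivWithinAt φ (a *ᵥ θ t + b (φ t)) (Icc 0 T) t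
  init : φ 0 = x
  deriv_momentum : ∀ t ∈ Icc 0 T,
    HasDerivWithinAt θ (-((jacobianMat b (φ t))ᵀ *ᵥ θ t)) (Icc 0 T) t
  final : θ T = gradVec f (φ T)

/-- The matrix path `W` solves on `[0, T]` the Riccati equation along `(φ, θ)`,
`W' = -∇∇⟨b(φ), θ⟩ - (∇b(φ))ᵀ W - W ∇b(φ) - W a W`, with `W(T) = ∇∇f(φ(T))`;
the derivative of `W` is taken entry by entry. -/
structure IsRiccatiSolution {n : ℕ} (a : Matrix (Fin n) (Fin n) ℝ)
    (b : (Fin n → ℝ) → (Fin n → ℝ)) (f : (Fin n → ℝ) → ℝ) (T : ℝ)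
    (φ θ : ℝ → (Fin n → ℝ)) (W : ℝ → Matrix (Fin n) (Fin n) ℝ) : Prop where
  deriv_entry : ∀ t ∈ Icc 0 T, ∀ i j,
    HasDerivWithinAt (fun s => W s i j)
      ((-driftHessian b (φ t) (θ t) - (jacobianMat b (φ t))ᵀ * W t
        - W t * jacobianMat b (φ t) - W t * a * W t) i j) (Icc 0 T) t
  final : W T = hessianMat f (φ T)

/-- The prefactor `R = exp (½ ∫₀ᵀ tr (a W(t)) dt)`. -/
def prefactor {n : ℕ} (a : Matrix (Fin n) (Fin n) ℝ) (T : ℝ)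
    (W : ℝ → Matrix (Fin n) (Fin n) ℝ) : ℝ :=
  Real.exp (1 / 2 * ∫ t in (0 : ℝ)..T, (a * W t).trace)

/-- `B` is an `n`-dimensional Wiener process: its components are independent
real Brownian motions. -/
structure IsWienerProcess {n : ℕ} {Ω : Type*} [MeasurableSpace Ω] (P : Measure Ω)
    (B : ℝ≥0 → Ω → (Fin n → ℝ)) : Prop where
  measurable : ∀ t, Measurable (B t)
  brownian : ∀ i, IsBrownianReal (fun t ω => B t ω i) P
  indep : iIndepFun (fun (i : Fin n) (ω : Ω) (t : ℝ≥0) => B t ω i) P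

/-- The process `Z` solves on `[0, T]` the linear equation with additive noise
`dZₜ = A(t) Zₜ dt + σ dBₜ`, `Z₀ = z`: almost surely its path is continuous and
`Zₜ = z + ∫₀ᵗ A(s) Zₛ ds + σ Bₜ` for all `t ∈ [0, T]`. Since `σ` is constant, the stochastic
integral is `σ Bₜ`. Such a `Z` is a functional of the path of `B`, so that adaptedness
need not be asked for. -/
structure IsLinearSDESolution {n : ℕ} {Ω : Type*} [MeasurableSpace Ω] (P : Measure Ω)
    (A : ℝ → Matrix (Fin n) (Fin n) ℝ) (σ : Matrix (Fin n) (Fin n) ℝ) (T : ℝ)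
    (z : Fin n → ℝ) (B : ℝ≥0 → Ω → (Fin n → ℝ)) (Z : ℝ → Ω → (Fin n → ℝ)) : Prop where
  measurable : ∀ t ∈ Icc 0 T, Measurable (Z t)
  continuous_paths : ∀ᵐ ω ∂P, ContinuousOn (fun t => Z t ω) (Icc 0 T)
  integral_eq : ∀ᵐ ω ∂P, ∀ t ∈ Icc 0 T,
    Z t ω = z + (∫ s in (0 : ℝ)..t, A s *ᵥ Z s ω) + σ *ᵥ B t.toNNReal ω

end

/-!
The identity is the one that Itô's formula for `½ W : Z Z` and Girsanov's theorem give: by the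
Riccati equation the exponent equals `½ ∫ tr (a W) dt` plus the logarithm of an exponential
martingale. The proof avoids stochastic integrals by carrying this out exactly for the Euler scheme
`Xₖ₊₁ = (1 + h A(tₖ)) Xₖ + σ ΔBₖ`, `h = T / N`, where `A = ∇b(φ)`, and then letting `N → ∞`.

* A Gaussian step maps the exponential of a quadratic form `Q` to the exponential of
  `Q + h Q a Q + o(h)`, times `exp (½ h tr (a Q) + o(h))` (`exists_gaussian_step`, by adding the
  noise one column of `σ` at a time). So for every `C¹` path `V` of symmetric matrices there are
  running costs `Cₖ = -h (V' + Aᵀ V + V A + V a V)(tₖ) + o(h)` and constants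
  `cₖ = h tr (a V(tₖ)) + o(h)` with
  `E exp (½ V(T) : X_N X_N + ½ ∑ₖ Cₖ : Xₖ Xₖ) = exp (½ ∑ₖ cₖ)` exactly
  (`exists_discrete_functional`). For `V = W`, which is symmetric (`isSymm_of_riccati`), the Riccati
  equation says that `Cₖ = h ∇∇⟨b(φ), θ⟩(tₖ) + o(h)`.
* The noise is additive, so the Euler scheme converges to `Z` uniformly on almost every path, by a
  Gronwall argument; hence the exponents converge almost surely (`tendsto_discrete_functional`).
* The expectations converge because a moment of some order `p > 1` of the discrete exponentials is
  bounded. This follows from the same identity for the strict supersolution `V = W + exp (-λ t)` of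
  the Riccati equation, whose costs dominate `p` times those of `W` (`exists_moment_bound`,
  `integrable_exp_and_integral_eq_of_tendsto`).

All estimates that are uniform in the step `k` are stated as limits along `gridFilter`.
-/

open Filter Asymptotics
open scoped Topology

attribute [local instance] Matrix.linftyOpNormedRing Matrix.linftyOpNormedAlgebra

/-! ### Quadratic forms -/

section QuadraticForms

variable {n : ℕ}

lemma quadContr_eq_dotProduct (A : Matrix (Fin n) (Fin n) ℝ) (z : Fin n → ℝ) :
    quadContr A z = z ⬝ᵥ (A *ᵥ z) := by
  simp only [quadContr, dotProduct, Matrix.mulVec, Finset.mul_sum]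
  exact Finset.sum_congr rfl fun i _ => Finset.sum_congr rfl fun j _ => by ring

lemma quadContr_add (A B : Matrix (Fin n) (Fin n) ℝ) (z : Fin n → ℝ) :
    quadContr (A + B) z = quadContr A z + quadContr B z := by
  simp [quadContr_eq_dotProduct, Matrix.add_mulVec, dotProduct_add]

lemma quadContr_sub (A B : Matrix (Fin n) (Fin n) ℝ) (z : Fin n → ℝ) :
    quadContr (A - B) z = quadContr A z - quadContr B z := by
  simp [quadContr_eq_dotProduct, Matrix.sub_mulVec, dotProduct_sub]

lemma quadContr_smul (r : ℝ) (A : Matrix (Fin n) (Fin n) ℝ) (z : Fin n → ℝ) :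
    quadContr (r • A) z = r * quadContr A z := by
  simp [quadContr_eq_dotProduct, Matrix.smul_mulVec]

lemma quadContr_one (z : Fin n → ℝ) : quadContr 1 z = z ⬝ᵥ z := by
  simp [quadContr_eq_dotProduct]

@[simp]
lemma quadContr_zero_right (A : Matrix (Fin n) (Fin n) ℝ) : quadContr A 0 = 0 := by
  simp [quadContr_eq_dotProduct]

lemma quadContr_mulVec (Q L : Matrix (Fin n) (Fin n) ℝ) (z : Fin n → ℝ) :
    quadContr Q (L *ᵥ z) = quadContr (Lᵀ * Q * L) z := by
  simp only [quadContr_eq_dotProduct, ← Matrix.mulVec_mulVec]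
  rw [Matrix.dotProduct_mulVec z, Matrix.vecMul_transpose]

lemma quadContr_mul_vecMulVec_mul {Q : Matrix (Fin n) (Fin n) ℝ} (hQ : Q.IsSymm)
    (s z : Fin n → ℝ) :
    quadContr (Q * Matrix.vecMulVec s s * Q) z = (s ⬝ᵥ (Q *ᵥ z)) ^ 2 := by
  have h := quadContr_mulVec (Matrix.vecMulVec s s) Q z
  rw [hQ.eq] at h
  rw [← h, quadContr_eq_dotProduct, Matrix.vecMulVec_mulVec]
  simp [dotProduct_comm (Q *ᵥ z) s, sq]

lemma quadContr_add_smul {Q : Matrix (Fin n) (Fin n) ℝ} (hQ : Q.IsSymm) (z s : Fin n → ℝ)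
    (r : ℝ) :
    quadContr Q (z + r • s)
      = quadContr Q z + 2 * r * (s ⬝ᵥ (Q *ᵥ z)) + r ^ 2 * quadContr Q s := by
  have h : z ⬝ᵥ (Q *ᵥ s) = s ⬝ᵥ (Q *ᵥ z) := by
    rw [Matrix.dotProduct_mulVec, ← Matrix.mulVec_transpose, hQ.eq, dotProduct_comm]
  simp only [quadContr_eq_dotProduct, Matrix.mulVec_add, Matrix.mulVec_smul, dotProduct_add,
    add_dotProduct, dotProduct_smul, smul_dotProduct, smul_eq_mul, h]
  ring

lemma continuous_quadContr :
    Continuous fun p : Matrix (Fin n) (Fin n) ℝ × (Fin n → ℝ) => quadContr p.1 p.2 := by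
  unfold quadContr
  fun_prop

@[fun_prop]
lemma Measurable.quadContr {Ω : Type*} [MeasurableSpace Ω] (Q : Matrix (Fin n) (Fin n) ℝ)
    {g : Ω → Fin n → ℝ} (hg : Measurable g) : Measurable fun ω => quadContr Q (g ω) := by
  unfold _root_.quadContr
  fun_prop

lemma abs_dotProduct_mulVec_le (M : Matrix (Fin n) (Fin n) ℝ) (u v : Fin n → ℝ) :
    |u ⬝ᵥ (M *ᵥ v)| ≤ n * (‖u‖ * ‖M‖ * ‖v‖) := by
  rw [dotProduct]
  calc |∑ i, u i * (M *ᵥ v) i| ≤ ∑ i, |u i * (M *ᵥ v) i| := Finset.abs_sum_le_sum_abs _ _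
    _ ≤ ∑ _i : Fin n, ‖u‖ * (‖M‖ * ‖v‖) := by
        refine Finset.sum_le_sum fun i _ => ?_
        rw [abs_mul]
        exact mul_le_mul (norm_le_pi_norm u i)
          ((norm_le_pi_norm (M *ᵥ v) i).trans (Matrix.linfty_opNorm_mulVec M v))
          (abs_nonneg _) (norm_nonneg _)
    _ = n * (‖u‖ * ‖M‖ * ‖v‖) := by
        rw [Finset.sum_const, Finset.card_univ, Fintype.card_fin, nsmul_eq_mul]; ring

lemma abs_quadContr_le (A : Matrix (Fin n) (Fin n) ℝ) (z : Fin n → ℝ) :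
    |quadContr A z| ≤ n * ‖A‖ * ‖z‖ ^ 2 := by
  rw [quadContr_eq_dotProduct]
  exact (abs_dotProduct_mulVec_le A z z).trans_eq (by ring)

/-- The sup norm is bounded by the Euclidean one. -/
lemma sq_norm_le_dotProduct_self (z : Fin n → ℝ) : ‖z‖ ^ 2 ≤ z ⬝ᵥ z := by
  have hz : 0 ≤ z ⬝ᵥ z := Finset.sum_nonneg fun i _ => mul_self_nonneg (z i)
  rw [← Real.le_sqrt (norm_nonneg z) hz]
  refine (pi_norm_le_iff_of_nonneg (Real.sqrt_nonneg _)).2 fun i => ?_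
  rw [Real.norm_eq_abs]
  refine Real.abs_le_sqrt ?_
  rw [sq]
  exact Finset.single_le_sum (f := fun i => z i * z i) (fun i _ => mul_self_nonneg (z i))
    (Finset.mem_univ i)

/-- A form dominated by a multiple of the identity, in terms of the matrix norm. -/
lemma abs_quadContr_le_dotProduct (A : Matrix (Fin n) (Fin n) ℝ) (z : Fin n → ℝ) :
    |quadContr A z| ≤ n * ‖A‖ * (z ⬝ᵥ z) :=
  (abs_quadContr_le A z).trans
    (mul_le_mul_of_nonneg_left (sq_norm_le_dotProduct_self z) (by positivity))

lemma quadContr_isBigO {ι : Type*} {l : Filter ι} {Q : ι → Matrix (Fin n) (Fin n) ℝ}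
    {g : ι → ℝ} (hQ : Q =O[l] g) (s : Fin n → ℝ) : (fun i => quadContr (Q i) s) =O[l] g := by
  refine IsBigO.trans (IsBigO.of_bound (n * ‖s‖ ^ 2) (.of_forall fun i => ?_)) hQ
  rw [Real.norm_eq_abs]
  exact (abs_quadContr_le _ _).trans_eq (by ring)

lemma quadContr_isLittleO {ι : Type*} {l : Filter ι} {Q : ι → Matrix (Fin n) (Fin n) ℝ}
    {g : ι → ℝ} (hQ : Q =o[l] g) (s : Fin n → ℝ) : (fun i => quadContr (Q i) s) =o[l] g := by
  refine IsBigO.trans_isLittleO (IsBigO.of_bound (n * ‖s‖ ^ 2) (.of_forall fun i => ?_)) hQ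
  rw [Real.norm_eq_abs]
  exact (abs_quadContr_le _ _).trans_eq (by ring)

end QuadraticForms

/-! ### Gaussian integrals of exponentials of quadratic forms -/

section GaussianStep

lemma lintegral_exp_quadratic_gaussianReal {v : ℝ≥0} (hv : v ≠ 0) {s : ℝ} (hs : v * s < 1)
    (u : ℝ) :
    ∫⁻ x, ENNReal.ofReal (Real.exp (u * x + s / 2 * x ^ 2)) ∂gaussianReal 0 v
      = ENNReal.ofReal (Real.exp (v / (1 - v * s) * u ^ 2 / 2 - Real.log (1 - v * s) / 2)) := by
  have hv0 : (0 : ℝ) < v := by positivity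
  have hd : 0 < 1 - v * s := by linarith
  -- The factor `exp (s x² / 2)` turns the density of variance `v` into a multiple of the
  -- density of variance `w = v / (1 - v s)`.
  set w : ℝ≥0 := (v / (1 - v * s)).toNNReal with hw
  have hwv : (w : ℝ) = v / (1 - v * s) := Real.coe_toNNReal _ (by positivity)
  have hw0 : w ≠ 0 := by
    have : (0 : ℝ) < w := by rw [hwv]; positivity
    exact_mod_cast this.ne'
  have key : ∀ x : ℝ, gaussianPDFReal 0 v x * Real.exp (u * x + s / 2 * x ^ 2)
      = Real.exp (-Real.log (1 - v * s) / 2) * (gaussianPDFReal 0 w x * Real.exp (u * x)) := by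
    intro x
    have h1 : Real.exp (-Real.log (1 - v * s) / 2) = (√(1 - v * s))⁻¹ := by
      rw [Real.sqrt_eq_rpow, ← Real.rpow_neg hd.le, Real.rpow_def_of_pos hd]
      congr 1; ring
    have h2 : √(2 * Real.pi * w) = √(2 * Real.pi * v) * (√(1 - v * s))⁻¹ := by
      rw [hwv, ← mul_div_assoc, Real.sqrt_div (by positivity), div_eq_mul_inv]
    have h3 : √(1 - v * s) ≠ 0 := (Real.sqrt_pos.2 hd).ne'
    rw [gaussianPDFReal, gaussianPDFReal, h1, h2, mul_inv, inv_inv]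
    rw [mul_assoc, ← Real.exp_add]
    rw [mul_assoc (_ * _) (Real.exp _), ← Real.exp_add, ← mul_assoc]
    congr 1
    · field_simp
    · congr 1
      rw [hwv]
      field_simp
      ring
  have hmgf : ∫⁻ x, ENNReal.ofReal (Real.exp (u * x)) ∂gaussianReal 0 w
      = ENNReal.ofReal (Real.exp (w * u ^ 2 / 2)) := by
    rw [← ofReal_integral_eq_lintegral_ofReal (integrable_exp_mul_gaussianReal u)
      (.of_forall fun x => (Real.exp_pos _).le)]
    have := mgf_gaussianReal (p := gaussianReal 0 w) (X := id) (μ := 0) (v := w) (by simp) u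
    simp only [mgf, id] at this
    rw [this]
    simp
  have hm : ∀ a : ℝ≥0, Measurable (gaussianPDF 0 a) := fun a => measurable_gaussianPDF 0 a
  rw [gaussianReal_of_var_ne_zero 0 hv,
    lintegral_withDensity_eq_lintegral_mul _ (hm v) (by fun_prop)]
  rw [gaussianReal_of_var_ne_zero 0 hw0,
    lintegral_withDensity_eq_lintegral_mul _ (hm w) (by fun_prop)] at hmgf
  have hpt : ∀ x : ℝ, (gaussianPDF 0 v * fun x => ENNReal.ofReal
        (Real.exp (u * x + s / 2 * x ^ 2))) x
      = ENNReal.ofReal (Real.exp (-Real.log (1 - v * s) / 2)) *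
        (gaussianPDF 0 w * fun x => ENNReal.ofReal (Real.exp (u * x))) x := by
    intro x
    simp only [Pi.mul_apply, gaussianPDF]
    rw [← ENNReal.ofReal_mul (gaussianPDFReal_nonneg _ _ _), key,
      ENNReal.ofReal_mul (Real.exp_pos _).le, ENNReal.ofReal_mul (gaussianPDFReal_nonneg _ _ _)]
  simp_rw [hpt]
  rw [lintegral_const_mul _ (by fun_prop), hmgf, ← ENNReal.ofReal_mul (Real.exp_pos _).le,
    ← Real.exp_add, hwv]
  congr 2
  ring

variable {n : ℕ}

lemma lintegral_exp_quadContr_gaussianReal {v : ℝ≥0} (hv : v ≠ 0)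
    {Q : Matrix (Fin n) (Fin n) ℝ} (hQ : Q.IsSymm) (s : Fin n → ℝ)
    (hs : v * quadContr Q s < 1) (z : Fin n → ℝ) :
    ∫⁻ x, ENNReal.ofReal (Real.exp (1 / 2 * quadContr Q (z + x • s))) ∂gaussianReal 0 v
      = ENNReal.ofReal (Real.exp (1 / 2 * quadContr
          (Q + ((v : ℝ) / (1 - v * quadContr Q s)) • (Q * Matrix.vecMulVec s s * Q)) z
          + 1 / 2 * -Real.log (1 - v * quadContr Q s))) := by
  have h : ∀ x : ℝ, ENNReal.ofReal (Real.exp (1 / 2 * quadContr Q (z + x • s)))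
      = ENNReal.ofReal (Real.exp (1 / 2 * quadContr Q z)) * ENNReal.ofReal
        (Real.exp ((s ⬝ᵥ (Q *ᵥ z)) * x + quadContr Q s / 2 * x ^ 2)) := by
    intro x
    rw [← ENNReal.ofReal_mul (Real.exp_pos _).le, ← Real.exp_add, quadContr_add_smul hQ]
    congr 2
    ring
  simp_rw [h]
  rw [lintegral_const_mul _ (by fun_prop), lintegral_exp_quadratic_gaussianReal hv hs,
    ← ENNReal.ofReal_mul (Real.exp_pos _).le, ← Real.exp_add, quadContr_add, quadContr_smul,
    quadContr_mul_vecMulVec_mul hQ]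
  congr 2
  ring

/-- Adding to `z` a centred Gaussian vector of small covariance `h a`, where
`a = ∑ⱼ sⱼ sⱼᵀ`, maps the exponential of a quadratic form `Q` to the exponential of another one,
`Q' = Q + h Q a Q + o(h)`, times a constant `exp (c / 2)` with `c = h tr (a Q) + o(h)`.
The asymptotics are uniform over bounded families `Q`. -/
theorem exists_gaussian_step {ι : Type*} {l : Filter ι} {h : ι → ℝ≥0}
    (hpos : ∀ᶠ i in l, h i ≠ 0) (h0 : Tendsto (fun i => (h i : ℝ)) l (𝓝 0)) :
    ∀ (m : ℕ) (s : Fin m → Fin n → ℝ) {Q : ι → Matrix (Fin n) (Fin n) ℝ},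
      (∀ᶠ i in l, (Q i).IsSymm) → Q =O[l] (fun _ => (1 : ℝ)) →
      ∃ (Q' : ι → Matrix (Fin n) (Fin n) ℝ) (c : ι → ℝ), (∀ᶠ i in l, (Q' i).IsSymm) ∧
        (fun i => Q' i - Q i
          - (h i : ℝ) • (Q i * (∑ j, Matrix.vecMulVec (s j) (s j)) * Q i))
            =o[l] (fun i => (h i : ℝ)) ∧
        (fun i => c i - h i * ∑ j, quadContr (Q i) (s j)) =o[l] (fun i => (h i : ℝ)) ∧
        ∀ᶠ i in l, ∀ z,
          ∫⁻ ξ, ENNReal.ofReal (Real.exp (1 / 2 * quadContr (Q i) (z + ∑ j, ξ j • s j)))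
              ∂Measure.pi (fun _ : Fin m => gaussianReal 0 (h i))
            = ENNReal.ofReal (Real.exp (1 / 2 * quadContr (Q' i) z + 1 / 2 * c i))
  | 0, s, Q, hsymm, _ => by
    refine ⟨Q, 0, hsymm, ?_, ?_, ?_⟩
    · simp
    · simp
    · refine .of_forall fun i z => ?_
      simp
  | m + 1, s, Q, hsymm, hQ => by
    obtain ⟨Q', c, hsymm', hQ', hc, hint⟩ :=
      exists_gaussian_step hpos h0 m (fun j => s j.succ) hsymm hQ
    have hO1 : (fun i => (h i : ℝ)) =o[l] (fun _ => (1 : ℝ)) := (isLittleO_one_iff ℝ).2 h0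
    set p := Matrix.vecMulVec (s 0) (s 0) with hp
    set a := ∑ j : Fin m, Matrix.vecMulVec (s j.succ) (s j.succ) with ha
    have hhO : (fun i => (h i : ℝ)) =O[l] (fun i => (h i : ℝ)) := isBigO_refl _ _
    have hdiff : (fun i => Q' i - Q i) =O[l] (fun i => (h i : ℝ)) := by
      have h1 : (fun i => (h i : ℝ) • (Q i * a * Q i)) =O[l] (fun i => (h i : ℝ)) := by
        simpa using hhO.smul ((hQ.mul (isBigO_const_const a one_ne_zero l)).mul hQ)
      simpa using hQ'.isBigO.add h1
    have hdiff1 : (fun i => Q' i - Q i) =o[l] (fun _ => (1 : ℝ)) := hdiff.trans_isLittleO hO1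
    have hQ'O : Q' =O[l] (fun _ => (1 : ℝ)) := by
      simpa using hdiff1.isBigO.add hQ
    set q : ι → ℝ := fun i => quadContr (Q' i) (s 0) with hq
    have hqO : q =O[l] (fun _ => (1 : ℝ)) := quadContr_isBigO hQ'O _
    have hhq : (fun i => (h i : ℝ) * q i) =O[l] (fun i => (h i : ℝ)) := by
      simpa using hhO.mul hqO
    have hhq0 : Tendsto (fun i => (h i : ℝ) * q i) l (𝓝 0) := hhq.trans_tendsto h0
    have hhalf : ∀ᶠ i in l, |(h i : ℝ) * q i| < 1 / 2 := by
      have := hhq0.abs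
      rw [abs_zero] at this
      exact this.eventually (gt_mem_nhds (by norm_num))
    refine ⟨fun i => Q' i + ((h i : ℝ) / (1 - h i * q i)) • (Q' i * p * Q' i),
      fun i => c i - Real.log (1 - h i * q i), ?_, ?_, ?_, ?_⟩
    · filter_upwards [hsymm'] with i hi
      have hp' : pᵀ = p := by rw [hp, Matrix.transpose_vecMulVec]
      unfold Matrix.IsSymm
      rw [Matrix.transpose_add, Matrix.transpose_smul, Matrix.transpose_mul, Matrix.transpose_mul,
        hi.eq, hp', ← Matrix.mul_assoc]
    · -- `Q'' - Q - h Q (p + a) Q` is the sum of the error of the previous steps,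
      -- `h (Q' p Q' - Q p Q)`, and `h (1 / (1 - h q) - 1) Q' p Q'`.
      have h1 : (fun i => (h i : ℝ) • (Q' i * p * Q' i - Q i * p * Q i))
          =o[l] (fun i => (h i : ℝ)) := by
        have e1 : (fun i => (Q' i - Q i) * p * Q' i) =o[l] (fun _ => (1 : ℝ)) := by
          simpa using ((hdiff1.mul_isBigO (isBigO_const_const p one_ne_zero l)).mul_isBigO hQ'O)
        have e2 : (fun i => Q i * p * (Q' i - Q i)) =o[l] (fun _ => (1 : ℝ)) := by
          simpa using ((hQ.mul (isBigO_const_const p one_ne_zero l)).mul_isLittleO hdiff1)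
        have e3 := hhO.smul_isLittleO (e1.add e2)
        refine (e3.congr_right (by simp)).congr_left fun i => ?_
        congr 1
        noncomm_ring
      have h2 : (fun i => ((h i : ℝ) / (1 - h i * q i) - h i)) =o[l] (fun i => (h i : ℝ)) := by
        have e1 : Tendsto (fun i => (1 - (h i : ℝ) * q i)⁻¹ - 1) l (𝓝 0) := by
          have := (tendsto_const_nhds (x := (1 : ℝ))).sub hhq0
          rw [sub_zero] at this
          simpa using (this.inv₀ one_ne_zero).sub_const 1
        have e2 := hhO.mul_isLittleO ((isLittleO_one_iff ℝ).2 e1)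
        refine (e2.congr_right (by simp)).congr_left fun i => ?_
        ring
      have h3 : (fun i => ((h i : ℝ) / (1 - h i * q i) - h i) • (Q' i * p * Q' i))
          =o[l] (fun i => (h i : ℝ)) := by
        simpa using h2.smul_isBigO ((hQ'O.mul (isBigO_const_const p one_ne_zero l)).mul hQ'O)
      refine ((hQ'.add h1).add h3).congr_left fun i => ?_
      rw [Fin.sum_univ_succ, ← ha, ← hp, mul_add, add_mul]
      module
    · have h1 : (fun i => -Real.log (1 - h i * q i) - h i * q i) =o[l] (fun i => (h i : ℝ)) := by
        have e1 : (fun i => -Real.log (1 - h i * q i) - h i * q i)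
            =O[l] (fun i => ((h i : ℝ) * q i) * (h i * q i)) := by
          refine IsBigO.of_bound 2 ?_
          filter_upwards [hhalf] with i hi
          have e := Real.abs_log_sub_add_sum_range_le (hi.trans (by norm_num)) 1
          simp only [Finset.sum_range_one, Nat.cast_zero, zero_add, pow_one, div_one] at e
          rw [Real.norm_eq_abs, Real.norm_eq_abs,
            show -Real.log (1 - h i * q i) - h i * q i
              = -(h i * q i + Real.log (1 - h i * q i)) by ring, abs_neg]
          refine e.trans ?_
          rw [div_le_iff₀ (by linarith), abs_mul (_ * _), one_add_one_eq_two]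
          nlinarith [sq_nonneg |(h i : ℝ) * q i|]
        have e2 : (fun i => ((h i : ℝ) * q i) * (h i * q i)) =o[l] (fun i => (h i : ℝ)) := by
          simpa using hhq.mul_isLittleO ((isLittleO_one_iff ℝ).2 hhq0)
        exact e1.trans_isLittleO e2
      have h2 : (fun i => (h i : ℝ) * (q i - quadContr (Q i) (s 0)))
          =o[l] (fun i => (h i : ℝ)) := by
        have e1 := quadContr_isLittleO hdiff1 (s 0)
        simp_rw [quadContr_sub] at e1
        simpa using hhO.mul_isLittleO e1
      refine ((hc.add h1).add h2).congr_left fun i => ?_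
      rw [Fin.sum_univ_succ]
      ring
    · filter_upwards [hint, hpos, hhalf, hsymm'] with i hi hpi hhalfi hsi z
      have hlt : (h i : ℝ) * quadContr (Q' i) (s 0) < 1 := by
        have := (abs_lt.1 hhalfi).2
        simp only [hq] at this
        linarith
      have hmp := (measurePreserving_piFinSuccAbove
        (fun _ : Fin (m + 1) => gaussianReal 0 (h i)) 0).symm
      rw [← MeasurePreserving.lintegral_comp_emb hmp (MeasurableEquiv.measurableEmbedding _)]
      rw [lintegral_prod _ (by
        refine Measurable.aemeasurable ?_
        refine ENNReal.measurable_ofReal.comp (Real.measurable_exp.comp ?_)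
        refine measurable_const.mul (Measurable.quadContr _ ?_)
        refine measurable_const.add (Finset.measurable_sum _ fun j _ => ?_)
        refine Measurable.smul_const ?_ _
        exact (measurable_pi_apply j).comp (MeasurableEquiv.measurable _))]
      have hsplit : ∀ (x : ℝ) (y : Fin m → ℝ),
          z + ∑ j, ((MeasurableEquiv.piFinSuccAbove (fun _ => ℝ) 0).symm (x, y)) j • s j
            = (z + x • s 0) + ∑ j, y j • s j.succ := by
        intro x y
        rw [Fin.sum_univ_succ]
        simp [MeasurableEquiv.piFinSuccAbove, add_assoc]
      simp_rw [hsplit]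
      simp_rw [hi, Real.exp_add, ENNReal.ofReal_mul (Real.exp_pos _).le]
      rw [lintegral_mul_const _ (by fun_prop),
        lintegral_exp_quadContr_gaussianReal hpi hsi (s 0) hlt,
        ← ENNReal.ofReal_mul (Real.exp_pos _).le, ← ENNReal.ofReal_mul (Real.exp_pos _).le,
        ← Real.exp_add, ← Real.exp_add]
      congr 2
      ring

end GaussianStep

/-! ### Linear Gaussian recursions -/

section EulerScheme

variable {n : ℕ}

/-- The recursion `X₀ = 0`, `Xₖ₊₁ = Lₖ Xₖ + σ ξₖ`; with `Lₖ = 1 + h A(tₖ)` and `ξₖ` the increments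
of the driving path it is the Euler scheme of the equation `dZ = A Z dt + σ dB`. -/
def eulerScheme (L : ℕ → Matrix (Fin n) (Fin n) ℝ) (σ : Matrix (Fin n) (Fin n) ℝ)
    (ξ : ℕ → Fin n → ℝ) : ℕ → Fin n → ℝ
  | 0 => 0
  | k + 1 => L k *ᵥ eulerScheme L σ ξ k + σ *ᵥ ξ k

@[fun_prop]
lemma measurable_const_mulVec {Ω : Type*} [MeasurableSpace Ω] (M : Matrix (Fin n) (Fin n) ℝ)
    {f : Ω → Fin n → ℝ} (hf : Measurable f) : Measurable fun ω => M *ᵥ f ω := by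
  refine measurable_pi_lambda _ fun i => ?_
  simp only [Matrix.mulVec, dotProduct]
  exact Finset.measurable_sum _ fun j _ => ((measurable_pi_apply j).comp hf).const_mul _

lemma measurable_eulerScheme {Ω : Type*} [MeasurableSpace Ω]
    (L : ℕ → Matrix (Fin n) (Fin n) ℝ) (σ : Matrix (Fin n) (Fin n) ℝ)
    {ξ : ℕ → Ω → Fin n → ℝ} : ∀ {k : ℕ}, (∀ i < k, Measurable (ξ i)) →
      Measurable fun ω => eulerScheme L σ (fun i => ξ i ω) k
  | 0, _ => measurable_const
  | k + 1, h => by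
    have h1 := measurable_eulerScheme L σ fun i hi => h i (hi.trans k.lt_succ_self)
    have h2 := h k k.lt_succ_self
    simp only [eulerScheme]
    fun_prop

lemma measurable_sum_quadContr_eulerScheme {Ω : Type*} [MeasurableSpace Ω]
    (L C : ℕ → Matrix (Fin n) (Fin n) ℝ) (σ : Matrix (Fin n) (Fin n) ℝ)
    {ξ : ℕ → Ω → Fin n → ℝ} {k : ℕ} (h : ∀ i < k, Measurable (ξ i)) :
    Measurable fun ω => ∑ i ∈ Finset.range k,
      quadContr (C i) (eulerScheme L σ (fun i => ξ i ω) i) := by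
  refine Finset.measurable_sum _ fun i hi => Measurable.quadContr _ ?_
  exact measurable_eulerScheme L σ fun j hj => h j (hj.trans (Finset.mem_range.1 hi))

lemma measurable_eulerScheme_prodMk {Ω : Type*} [MeasurableSpace Ω]
    (L C : ℕ → Matrix (Fin n) (Fin n) ℝ) (σ : Matrix (Fin n) (Fin n) ℝ)
    {ξ : ℕ → Ω → Fin n → ℝ} {k : ℕ} (h : ∀ i < k, Measurable (ξ i)) :
    Measurable fun ω => (eulerScheme L σ (fun i => ξ i ω) k, ∑ i ∈ Finset.range k,
      quadContr (C i) (eulerScheme L σ (fun i => ξ i ω) i)) :=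
  (measurable_eulerScheme L σ h).prodMk (measurable_sum_quadContr_eulerScheme L C σ h)

/-- If one step of the noise maps `exp (Qₖ₊₁ / 2)` to `exp (Q'ₖ / 2 + cₖ / 2)` and
`Cₖ = Qₖ - Lₖᵀ Q'ₖ Lₖ`, then
`exp (½ Qₖ : Xₖ Xₖ + ½ ∑_{i < k} (Cᵢ : Xᵢ Xᵢ - cᵢ))` is a martingale of mean one. -/
theorem lintegral_exp_eulerScheme {Ω : Type*} [mΩ : MeasurableSpace Ω] {P : Measure Ω}
    [IsProbabilityMeasure P] {σ : Matrix (Fin n) (Fin n) ℝ}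
    {ξ : ℕ → Ω → Fin n → ℝ} {𝓕 : ℕ → MeasurableSpace Ω} (h𝓕 : ∀ k, 𝓕 k ≤ mΩ)
    (hξ𝓕 : ∀ k, ∀ i < k, Measurable[𝓕 k] (ξ i)) (hξ : ∀ k, Measurable (ξ k))
    (hind : ∀ k, Indep (𝓕 k) (MeasurableSpace.comap (ξ k) inferInstance) P)
    {γ : Measure (Fin n → ℝ)} (hlaw : ∀ k, P.map (ξ k) = γ)
    {L Q Q' C : ℕ → Matrix (Fin n) (Fin n) ℝ} {c : ℕ → ℝ} {N : ℕ}
    (hstep : ∀ k < N, ∀ z, ∫⁻ x, ENNReal.ofReal (Real.exp (1 / 2 * quadContr (Q (k + 1))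
        (z + σ *ᵥ x))) ∂γ = ENNReal.ofReal (Real.exp (1 / 2 * quadContr (Q' k) z + 1 / 2 * c k)))
    (hC : ∀ k < N, C k = Q k - (L k)ᵀ * Q' k * L k) :
    ∀ k ≤ N, ∫⁻ ω, ENNReal.ofReal (Real.exp
        (1 / 2 * quadContr (Q k) (eulerScheme L σ (fun i => ξ i ω) k)
          + 1 / 2 * ∑ i ∈ Finset.range k,
            quadContr (C i) (eulerScheme L σ (fun i => ξ i ω) i))) ∂P
      = ENNReal.ofReal (Real.exp (1 / 2 * ∑ i ∈ Finset.range k, c i))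
  | 0, _ => by simp [eulerScheme]
  | k + 1, hk => by
    have ih := lintegral_exp_eulerScheme h𝓕 hξ𝓕 hξ hind hlaw hstep hC k (Nat.le_of_succ_le hk)
    set X : Ω → Fin n → ℝ := fun ω => eulerScheme L σ (fun i => ξ i ω) k with hX
    set S : Ω → ℝ := fun ω => ∑ i ∈ Finset.range k,
      quadContr (C i) (eulerScheme L σ (fun i => ξ i ω) i) with hS
    have hU𝓕 : Measurable[𝓕 k] fun ω => (X ω, S ω) :=
      @measurable_eulerScheme_prodMk n Ω (𝓕 k) L C σ ξ k (hξ𝓕 k)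
    have hU : Measurable fun ω => (X ω, S ω) := hU𝓕.mono (h𝓕 k) le_rfl
    have hUξ : IndepFun (fun ω => (X ω, S ω)) (ξ k) P :=
      indep_of_indep_of_le_left (hind k) hU𝓕.comap_le
    have hmap : P.map (fun ω => ((X ω, S ω), ξ k ω)) = (P.map fun ω => (X ω, S ω)).prod γ := by
      rw [hUξ.map_prod_eq_prod_map_map hU.aemeasurable (hξ k).aemeasurable, hlaw k]
    have : IsProbabilityMeasure γ := by
      rw [← hlaw k]
      exact Measure.isProbabilityMeasure_map (hξ k).aemeasurable
    let Φ : ((Fin n → ℝ) × ℝ) × (Fin n → ℝ) → ENNReal := fun p =>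
      ENNReal.ofReal (Real.exp (1 / 2 * p.1.2 + 1 / 2 * quadContr (C k) p.1.1)) *
      ENNReal.ofReal (Real.exp (1 / 2 * quadContr (Q (k + 1)) (L k *ᵥ p.1.1 + σ *ᵥ p.2)))
    have hΦ : Measurable Φ := by
      fun_prop
    calc _ = ∫⁻ ω, Φ ((X ω, S ω), ξ k ω) ∂P := by
          refine lintegral_congr fun ω => ?_
          simp only [Φ]
          rw [← ENNReal.ofReal_mul (Real.exp_pos _).le, ← Real.exp_add, Finset.sum_range_succ]
          congr 2
          simp only [eulerScheme, hX, hS]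
          ring
      _ = ∫⁻ p, Φ p ∂(P.map fun ω => (X ω, S ω)).prod γ := by
          rw [← hmap, lintegral_map hΦ (hU.prodMk (hξ k))]
      _ = ∫⁻ u, ENNReal.ofReal (Real.exp (1 / 2 * c k)) * ENNReal.ofReal (Real.exp
            (1 / 2 * quadContr (Q k) u.1 + 1 / 2 * u.2)) ∂(P.map fun ω => (X ω, S ω)) := by
          rw [lintegral_prod _ hΦ.aemeasurable]
          refine lintegral_congr fun u => ?_
          simp only [Φ]
          rw [lintegral_const_mul _ (by fun_prop), hstep k hk,
            ← ENNReal.ofReal_mul (Real.exp_pos _).le,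
            ← ENNReal.ofReal_mul (Real.exp_pos _).le, ← Real.exp_add, ← Real.exp_add,
            hC k hk, quadContr_sub, quadContr_mulVec]
          congr 2
          ring
      _ = _ := by
          have hm : Measurable fun u : (Fin n → ℝ) × ℝ => ENNReal.ofReal (Real.exp
              (1 / 2 * quadContr (Q k) u.1 + 1 / 2 * u.2)) := by
            fun_prop
          rw [lintegral_const_mul _ hm, lintegral_map hm hU, ih,
            ← ENNReal.ofReal_mul (Real.exp_pos _).le, ← Real.exp_add, Finset.sum_range_succ]
          congr 2
          ring

end EulerScheme

/-! ### Increments of a Wiener process -/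

section Increments

/-- The increments of the process `B` over the intervals `[k h, (k + 1) h]`. -/
def increment {n : ℕ} {Ω : Type*} (B : ℝ≥0 → Ω → Fin n → ℝ) (h : ℝ≥0) (k : ℕ) (ω : Ω) : Fin n → ℝ :=
  B ((k + 1 : ℕ) * h) ω - B (k * h) ω

/-- The information carried by the increments before time `k h`. -/
@[reducible]
def pastIncrements {n : ℕ} {Ω : Type*} (B : ℝ≥0 → Ω → Fin n → ℝ) (h : ℝ≥0) (k : ℕ) :
    MeasurableSpace Ω :=
  ⨆ p ∈ {p : Fin n × ℕ | p.2 < k},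
    MeasurableSpace.comap (fun ω => increment B h p.2 ω p.1) inferInstance

lemma measurable_pastIncrements {n : ℕ} {Ω : Type*} (B : ℝ≥0 → Ω → Fin n → ℝ)
    (h : ℝ≥0) {k i : ℕ} (hi : i < k) :
    Measurable[pastIncrements B h k] (increment B h i) := by
  refine @measurable_pi_lambda _ _ _ (pastIncrements B h k) _ _ fun j => ?_
  refine (comap_measurable (fun ω => increment B h i ω j)).mono ?_ le_rfl
  exact le_iSup₂_of_le (j, i) hi le_rfl

variable {n : ℕ} {Ω : Type*} [mΩ : MeasurableSpace Ω] {P : Measure Ω}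
  {B : ℝ≥0 → Ω → Fin n → ℝ}

lemma IsWienerProcess.measurable_increment (hB : IsWienerProcess P B) (h : ℝ≥0) (k : ℕ) :
    Measurable (increment B h k) :=
  (hB.measurable _).sub (hB.measurable _)

/-- The increments of all components over all intervals of the grid are independent. -/
lemma IsWienerProcess.iIndepFun_increment (hB : IsWienerProcess P B) (h : ℝ≥0) :
    iIndepFun (fun (p : Fin n × ℕ) ω => increment B h p.2 ω p.1) P := by
  refine iIndepFun_uncurry' (X := fun j k ω => increment B h k ω j)
    (fun j k => (measurable_pi_apply j).comp (hB.measurable_increment h k)) ?_ fun j => ?_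
  · refine hB.indep.comp
      (fun _ (w : ℝ≥0 → ℝ) (k : ℕ) => w ((k + 1 : ℕ) * h) - w (k * h)) fun _ => ?_
    fun_prop
  · refine (hB.brownian j).hasIndepIncrements.nat (t := fun k : ℕ => k * h) fun a b hab => ?_
    have : (a : ℝ≥0) ≤ b := by exact_mod_cast hab
    exact mul_le_mul_left this h

lemma IsWienerProcess.map_increment (hB : IsWienerProcess P B) (h : ℝ≥0) (k : ℕ) :
    P.map (increment B h k) = Measure.pi fun _ : Fin n => gaussianReal 0 h := by
  have h1 : iIndepFun (fun (j : Fin n) ω => increment B h k ω j) P :=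
    (hB.iIndepFun_increment h).precomp (g := fun j => (j, k)) fun a b hab => by simpa using hab
  have h2 := h1.map_fun_eq_pi_map fun j =>
    ((measurable_pi_apply j).comp (hB.measurable_increment h k)).aemeasurable
  refine Eq.trans h2 ?_
  congr 1
  funext j
  have h3 := ((hB.brownian j).hasLaw_sub ((k + 1 : ℕ) * h) (k * h)).map_eq
  refine Eq.trans h3 ?_
  congr 1
  ext
  rw [coe_nndist, Real.dist_eq]
  change |(((k + 1 : ℕ) * h : ℝ≥0) : ℝ) - ((k * h : ℝ≥0) : ℝ)| = h
  push_cast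
  rw [show ((k : ℝ) + 1) * h - k * h = h by ring, abs_of_nonneg h.coe_nonneg]

lemma IsWienerProcess.pastIncrements_le (hB : IsWienerProcess P B) (h : ℝ≥0) (k : ℕ) :
    pastIncrements B h k ≤ mΩ :=
  iSup₂_le fun p _ => ((measurable_pi_apply p.1).comp (hB.measurable_increment h p.2)).comap_le

lemma IsWienerProcess.indep_pastIncrements (hB : IsWienerProcess P B) (h : ℝ≥0) (k : ℕ) :
    Indep (pastIncrements B h k) (MeasurableSpace.comap (increment B h k) inferInstance) P := by
  have h1 := indep_iSup_of_disjoint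
    (fun p : Fin n × ℕ =>
      ((measurable_pi_apply p.1).comp (hB.measurable_increment h p.2)).comap_le)
    (hB.iIndepFun_increment h).iIndep
    (S := {p | p.2 < k}) (T := {p | p.2 = k})
    (Set.disjoint_left.2 fun p hp hp' => by simp at hp hp'; omega)
  refine indep_of_indep_of_le_right h1 ?_
  refine Measurable.comap_le ?_
  refine @measurable_pi_lambda _ _ _
    (⨆ p ∈ {p : Fin n × ℕ | p.2 = k},
      MeasurableSpace.comap (fun ω => increment B h p.2 ω p.1) inferInstance) _ _ fun j => ?_
  refine (comap_measurable (fun ω => increment B h k ω j)).mono ?_ le_rfl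
  exact le_iSup₂_of_le (j, k) rfl le_rfl

end Increments

/-! ### Uniform asymptotics along a refining grid -/

section Grid

/-- The filter on the pairs `(N, k)` with `k < N` along which `N → ∞`. A limit along this filter is
a limit as `N → ∞`, uniform in the index `k` of the step. -/
def gridFilter : Filter (ℕ × ℕ) :=
  comap Prod.fst atTop ⊓ 𝓟 {p | p.2 < p.1}

lemma eventually_gridFilter {R : ℕ × ℕ → Prop} :
    (∀ᶠ p in gridFilter, R p) ↔ ∀ᶠ N in atTop, ∀ k < N, R (N, k) := by
  rw [gridFilter, eventually_inf_principal, eventually_comap]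
  refine eventually_congr (.of_forall fun N => ?_)
  constructor
  · intro h k hk
    exact h (N, k) rfl hk
  · rintro h ⟨N', k⟩ rfl hk
    exact h k hk

/-- The point `k T / N` of the uniform grid with `N` steps on `[0, T]`. -/
noncomputable def gridPoint (T : ℝ) (N k : ℕ) : ℝ := k * (T / N)

variable {T : ℝ}

@[simp]
lemma gridPoint_zero (T : ℝ) (N : ℕ) : gridPoint T N 0 = 0 := by simp [gridPoint]

lemma gridPoint_succ (T : ℝ) (N k : ℕ) : gridPoint T N (k + 1) = gridPoint T N k + T / N := by
  simp [gridPoint]; ring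

lemma gridPoint_self (T : ℝ) {N : ℕ} (hN : N ≠ 0) : gridPoint T N N = T := by
  have : (N : ℝ) ≠ 0 := by exact_mod_cast hN
  rw [gridPoint]; field_simp

lemma gridPoint_mem (hT : 0 ≤ T) {N k : ℕ} (hk : k ≤ N) : gridPoint T N k ∈ Icc 0 T := by
  rcases Nat.eq_zero_or_pos N with rfl | hN
  · simp [gridPoint, hT]
  have : (0 : ℝ) < N := by exact_mod_cast hN
  have hk' : (k : ℝ) ≤ N := by exact_mod_cast hk
  refine ⟨by unfold gridPoint; positivity, ?_⟩
  rw [gridPoint, ← mul_div_assoc, div_le_iff₀ this, mul_comm]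
  exact mul_le_mul_of_nonneg_left hk' hT

lemma gridPoint_le_succ (hT : 0 ≤ T) (N k : ℕ) : gridPoint T N k ≤ gridPoint T N (k + 1) := by
  rw [gridPoint_succ]
  have : 0 ≤ T / N := by positivity
  linarith

lemma tendsto_gridStep (T : ℝ) : Tendsto (fun p : ℕ × ℕ => T / p.1) gridFilter (𝓝 0) :=
  (tendsto_const_div_atTop_nhds_zero_nat T).comp (tendsto_comap.mono_left inf_le_left)

lemma eventually_lt_gridFilter : ∀ᶠ p in gridFilter, p.2 < p.1 :=
  eventually_inf_principal.2 (.of_forall fun _ h => h)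

variable {E : Type*} [NormedAddCommGroup E]

lemma isBigO_gridFilter_of_continuousOn (hT : 0 ≤ T) {g : ℝ → E} (hg : ContinuousOn g (Icc 0 T)) :
    (fun p => g (gridPoint T p.1 p.2)) =O[gridFilter] fun _ => (1 : ℝ) := by
  obtain ⟨K, hK⟩ := isCompact_Icc.exists_bound_of_continuousOn hg
  refine IsBigO.of_bound K ?_
  filter_upwards [eventually_lt_gridFilter] with p hp
  simpa using hK _ (gridPoint_mem hT hp.le)

lemma isBigO_gridFilter_of_continuousOn_succ (hT : 0 ≤ T) {g : ℝ → E}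
    (hg : ContinuousOn g (Icc 0 T)) :
    (fun p => g (gridPoint T p.1 (p.2 + 1))) =O[gridFilter] fun _ => (1 : ℝ) := by
  obtain ⟨K, hK⟩ := isCompact_Icc.exists_bound_of_continuousOn hg
  refine IsBigO.of_bound K ?_
  filter_upwards [eventually_lt_gridFilter] with p hp
  simpa using hK _ (gridPoint_mem hT hp)

/-- A continuous function oscillates little on each interval of a fine grid. -/
lemma eventually_gridFilter_oscillation (hT : 0 ≤ T) {g : ℝ → E} (hg : ContinuousOn g (Icc 0 T))
    {ε : ℝ} (hε : 0 < ε) :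
    ∀ᶠ p in gridFilter, ∀ s ∈ Icc (gridPoint T p.1 p.2) (gridPoint T p.1 (p.2 + 1)),
      ‖g s - g (gridPoint T p.1 p.2)‖ ≤ ε := by
  have hu := isCompact_Icc.uniformContinuousOn_of_continuous hg
  obtain ⟨δ, hδ, hu⟩ := Metric.uniformContinuousOn_iff.1 hu ε hε
  filter_upwards [eventually_lt_gridFilter, (tendsto_gridStep T).eventually (gt_mem_nhds hδ)]
    with p hp hpδ s hs
  have h1 := gridPoint_mem hT hp.le
  have h2 : gridPoint T p.1 (p.2 + 1) ∈ Icc 0 T := gridPoint_mem hT hp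
  rw [← dist_eq_norm]
  refine (hu s ⟨h1.1.trans hs.1, hs.2.trans h2.2⟩ _ h1 ?_).le
  rw [gridPoint_succ] at hs
  rw [Real.dist_eq, abs_of_nonneg (by linarith [hs.1])]
  linarith [hs.2]

lemma sub_isLittleO_one_gridFilter (hT : 0 ≤ T) {g : ℝ → E} (hg : ContinuousOn g (Icc 0 T)) :
    (fun p => g (gridPoint T p.1 (p.2 + 1)) - g (gridPoint T p.1 p.2))
      =o[gridFilter] fun _ => (1 : ℝ) := by
  refine isLittleO_iff.2 fun ε hε => ?_
  filter_upwards [eventually_gridFilter_oscillation hT hg hε] with p hp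
  simpa using hp _ (right_mem_Icc.2 (gridPoint_le_succ hT _ _))

variable [NormedSpace ℝ E]

lemma sub_sub_smul_isLittleO_gridFilter (hT : 0 ≤ T) {g g' : ℝ → E}
    (hg : ∀ t ∈ Icc 0 T, HasDerivWithinAt g (g' t) (Icc 0 T) t)
    (hg' : ContinuousOn g' (Icc 0 T)) :
    (fun p : ℕ × ℕ => g (gridPoint T p.1 (p.2 + 1)) - g (gridPoint T p.1 p.2)
        - (T / p.1) • g' (gridPoint T p.1 p.2)) =o[gridFilter] fun p => T / (p.1 : ℝ) := by
  refine isLittleO_iff.2 fun ε hε => ?_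
  filter_upwards [eventually_gridFilter_oscillation hT hg' hε, eventually_lt_gridFilter]
    with p hp hlt
  set a := gridPoint T p.1 p.2 with ha
  set b := gridPoint T p.1 (p.2 + 1) with hb
  have hab : a ≤ b := gridPoint_le_succ hT _ _
  have hba : b - a = T / p.1 := by rw [hb, gridPoint_succ]; ring
  have hsub : Icc a b ⊆ Icc 0 T :=
    Icc_subset_Icc (gridPoint_mem hT hlt.le).1 (gridPoint_mem hT hlt).2
  have hder : ∀ s ∈ Icc a b, HasDerivWithinAt (fun s => g s - s • g' a) (g' s - g' a)
      (Icc a b) s := fun s hs => by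
    have := ((hg s (hsub hs)).mono hsub).fun_sub
      ((hasDerivWithinAt_id s (Icc a b)).smul_const (g' a))
    simpa using this
  have := (convex_Icc a b).norm_image_sub_le_of_norm_hasDerivWithin_le hder hp
    (left_mem_Icc.2 hab) (right_mem_Icc.2 hab)
  rw [Real.norm_eq_abs (b - a), Real.norm_eq_abs] at *
  rw [hba] at this
  convert this using 2
  rw [← hba, sub_smul]
  abel

lemma integral_sub_smul_isLittleO_gridFilter [CompleteSpace E] (hT : 0 ≤ T) {g : ℝ → E}
    (hg : ContinuousOn g (Icc 0 T)) :
    (fun p : ℕ × ℕ => (∫ s in gridPoint T p.1 p.2..gridPoint T p.1 (p.2 + 1), g s)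
        - (T / p.1) • g (gridPoint T p.1 p.2)) =o[gridFilter] fun p => T / (p.1 : ℝ) := by
  refine isLittleO_iff.2 fun ε hε => ?_
  filter_upwards [eventually_gridFilter_oscillation hT hg hε, eventually_lt_gridFilter]
    with p hp hlt
  set a := gridPoint T p.1 p.2 with ha
  set b := gridPoint T p.1 (p.2 + 1) with hb
  have hab : a ≤ b := gridPoint_le_succ hT _ _
  have hba : b - a = T / p.1 := by rw [hb, gridPoint_succ]; ring
  have hsub : Icc a b ⊆ Icc 0 T :=
    Icc_subset_Icc (gridPoint_mem hT hlt.le).1 (gridPoint_mem hT hlt).2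
  have hint : IntervalIntegrable g volume a b :=
    (hg.mono hsub).intervalIntegrable_of_Icc hab
  have h1 : (∫ s in a..b, g s) - (T / p.1) • g a = ∫ s in a..b, (g s - g a) := by
    rw [intervalIntegral.integral_sub hint intervalIntegrable_const,
      intervalIntegral.integral_const, hba]
  rw [h1, ← hba, Real.norm_eq_abs]
  refine intervalIntegral.norm_integral_le_of_norm_le_const fun s hs => ?_
  rw [uIoc_of_le hab] at hs
  exact hp s (Ioc_subset_Icc_self hs)

lemma sum_integral_gridPoint (hT : 0 ≤ T)
    {g : ℝ → E} (hg : ContinuousOn g (Icc 0 T)) {N : ℕ} (hN : N ≠ 0) :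
    ∑ k ∈ Finset.range N, ∫ s in gridPoint T N k..gridPoint T N (k + 1), g s
      = ∫ s in (0 : ℝ)..T, g s := by
  rw [intervalIntegral.sum_integral_adjacent_intervals (a := gridPoint T N)]
  · rw [gridPoint_zero, gridPoint_self T hN]
  · intro k hk
    refine (hg.mono ?_).intervalIntegrable_of_Icc (gridPoint_le_succ hT N k)
    exact Icc_subset_Icc (gridPoint_mem hT hk.le).1 (gridPoint_mem hT hk).2

/-- Sums of `N` terms which are `h g(tₖ) + o(h)`, uniformly in `k`, converge to `∫ g`. -/
lemma tendsto_sum_gridFilter (hT : 0 ≤ T) {g : ℝ → ℝ} (hg : ContinuousOn g (Icc 0 T))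
    {a : ℕ × ℕ → ℝ}
    (ha : (fun p => a p - T / p.1 * g (gridPoint T p.1 p.2)) =o[gridFilter]
      fun p => T / (p.1 : ℝ)) :
    Tendsto (fun N => ∑ k ∈ Finset.range N, a (N, k)) atTop (𝓝 (∫ s in (0 : ℝ)..T, g s)) := by
  have h1 := ha.sub (integral_sub_smul_isLittleO_gridFilter hT hg)
  rw [← tendsto_sub_nhds_zero_iff, Metric.tendsto_nhds]
  intro ε hε
  have h2 := isLittleO_iff.1 h1 (c := ε / (2 * (T + 1))) (by positivity)
  filter_upwards [eventually_gridFilter.1 h2, eventually_ne_atTop 0] with N hN hN0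
  rw [dist_zero_right, ← sum_integral_gridPoint hT hg hN0, ← Finset.sum_sub_distrib]
  have hNpos : (0 : ℝ) < N := by positivity
  calc _ ≤ ∑ k ∈ Finset.range N, ε / (2 * (T + 1)) * (T / N) := by
        refine norm_sum_le_of_le _ fun k hk => ?_
        have := hN k (Finset.mem_range.1 hk)
        rw [Real.norm_of_nonneg (div_nonneg hT hNpos.le)] at this
        refine le_trans (le_of_eq ?_) this
        congr 1
        simp only [smul_eq_mul]
        ring
    _ = ε / 2 * (T / (T + 1)) := by simp; field_simp
    _ ≤ ε / 2 * 1 := by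
        gcongr
        rw [div_le_one (by linarith)]; linarith
    _ < ε := by linarith

end Grid

/-! ### The discrete exponential functional -/

section DiscreteFunctional

variable {n : ℕ}

/-- The `k`-th state of the Euler scheme with `N` steps on `[0, T]` of the equation
`dZ = A Z dt + σ dB`, `Z₀ = 0`. -/
noncomputable def gridEuler {Ω : Type*} (A : ℝ → Matrix (Fin n) (Fin n) ℝ)
    (σ : Matrix (Fin n) (Fin n) ℝ) (T : ℝ) (B : ℝ≥0 → Ω → Fin n → ℝ) (N k : ℕ) (ω : Ω) : Fin n → ℝ :=
  eulerScheme (fun k => 1 + (T / N) • A (gridPoint T N k)) σ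
    (fun k => increment B (T / N).toNNReal k ω) k

lemma mulVec_eq_sum_smul (σ : Matrix (Fin n) (Fin n) ℝ) (x : Fin n → ℝ) :
    σ *ᵥ x = ∑ j, x j • fun i => σ i j := by
  ext i
  simp [Matrix.mulVec, dotProduct, mul_comm]

lemma sum_vecMulVec_col (σ : Matrix (Fin n) (Fin n) ℝ) :
    ∑ j, Matrix.vecMulVec (fun i => σ i j) (fun i => σ i j) = σ * σᵀ := by
  ext i j
  simp [Matrix.sum_apply, Matrix.vecMulVec_apply, Matrix.mul_apply]

lemma sum_quadContr_col (σ V : Matrix (Fin n) (Fin n) ℝ) :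
    ∑ j, quadContr V (fun i => σ i j) = (σ * σᵀ * V).trace := by
  have h : ∀ j, quadContr V (fun i => σ i j)
      = (V * Matrix.vecMulVec (fun i => σ i j) (fun i => σ i j)).trace := fun j => by
    rw [quadContr_eq_dotProduct, Matrix.mul_vecMulVec, Matrix.trace_vecMulVec, dotProduct_comm]
  simp_rw [h]
  rw [← Matrix.trace_sum, ← Finset.mul_sum, sum_vecMulVec_col, Matrix.trace_mul_comm]

/-- For every `C¹` path `V` of symmetric matrices there are discrete running costs
`C = -h (V' + Aᵀ V + V A + V a V) + o(h)` and constants `c = h tr (a V) + o(h)` for which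
`½ V(T) : X_N X_N + ½ ∑ₖ Cₖ : Xₖ Xₖ` has exponential moment exactly `exp (½ ∑ₖ cₖ)`. -/
theorem exists_discrete_functional {Ω : Type*} [MeasurableSpace Ω] {P : Measure Ω}
    [IsProbabilityMeasure P] {B : ℝ≥0 → Ω → Fin n → ℝ} (hB : IsWienerProcess P B)
    (σ : Matrix (Fin n) (Fin n) ℝ) {T : ℝ} (hT : 0 < T)
    {A V V' : ℝ → Matrix (Fin n) (Fin n) ℝ} (hA : ContinuousOn A (Icc 0 T))
    (hVsymm : ∀ t ∈ Icc 0 T, (V t).IsSymm)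
    (hV : ∀ t ∈ Icc 0 T, HasDerivWithinAt V (V' t) (Icc 0 T) t)
    (hV' : ContinuousOn V' (Icc 0 T)) :
    ∃ (C : ℕ × ℕ → Matrix (Fin n) (Fin n) ℝ) (c : ℕ × ℕ → ℝ),
      (fun p => C p - (T / p.1) • (fun t => -(V' t + (A t)ᵀ * V t + V t * A t
          + V t * (σ * σᵀ) * V t)) (gridPoint T p.1 p.2)) =o[gridFilter]
        (fun p => T / (p.1 : ℝ)) ∧
      (fun p => c p - T / p.1 * (σ * σᵀ * V (gridPoint T p.1 p.2)).trace) =o[gridFilter]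
        (fun p => T / (p.1 : ℝ)) ∧
      ∀ᶠ N in atTop, ∫⁻ ω, ENNReal.ofReal (Real.exp
          (1 / 2 * quadContr (V T) (gridEuler A σ T B N N ω)
            + 1 / 2 * ∑ k ∈ Finset.range N, quadContr (C (N, k)) (gridEuler A σ T B N k ω))) ∂P
        = ENNReal.ofReal (Real.exp (1 / 2 * ∑ k ∈ Finset.range N, c (N, k))) := by
  have hT0 := hT.le
  have hVc : ContinuousOn V (Icc 0 T) := fun t ht => (hV t ht).continuousWithinAt
  set a := σ * σᵀ with ha
  set h : ℕ × ℕ → ℝ := fun p => T / p.1 with hh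
  have hcoe : ∀ p : ℕ × ℕ, (((T / p.1).toNNReal : ℝ≥0) : ℝ) = h p := fun p =>
    Real.coe_toNNReal _ (by positivity)
  have hO1 : h =o[gridFilter] (fun _ => (1 : ℝ)) := (isLittleO_one_iff ℝ).2 (tendsto_gridStep T)
  have hhO : h =O[gridFilter] h := isBigO_refl _ _
  obtain ⟨Q', c, -, hQ', hc, hint⟩ := exists_gaussian_step (l := gridFilter)
    (h := fun p => (T / p.1).toNNReal)
    (by
      filter_upwards [eventually_lt_gridFilter] with p hp
      have : (0 : ℝ) < p.1 := by exact_mod_cast (Nat.zero_le _).trans_lt hp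
      exact (Real.toNNReal_pos.2 (by positivity)).ne')
    (by simpa only [hcoe] using tendsto_gridStep T) n (fun j i => σ i j)
    (Q := fun p => V (gridPoint T p.1 (p.2 + 1)))
    (by
      filter_upwards [eventually_lt_gridFilter] with p hp
      exact hVsymm _ (gridPoint_mem hT0 hp))
    (isBigO_gridFilter_of_continuousOn_succ hT0 hVc)
  simp only [hcoe, sum_vecMulVec_col, sum_quadContr_col] at hQ' hc
  rw [← ha] at hQ'
  set t : ℕ × ℕ → ℝ := fun p => gridPoint T p.1 p.2 with ht
  set V₁ : ℕ × ℕ → Matrix (Fin n) (Fin n) ℝ := fun p => V (gridPoint T p.1 (p.2 + 1)) with hV₁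
  have hAO : (fun p => A (t p)) =O[gridFilter] fun _ => (1 : ℝ) :=
    isBigO_gridFilter_of_continuousOn hT0 hA
  have hAtO : (fun p => (A (t p))ᵀ) =O[gridFilter] fun _ => (1 : ℝ) :=
    isBigO_gridFilter_of_continuousOn hT0 (g := fun t => (A t)ᵀ)
      (continuous_id.matrix_transpose.comp_continuousOn hA)
  have hVO : (fun p => V (t p)) =O[gridFilter] fun _ => (1 : ℝ) :=
    isBigO_gridFilter_of_continuousOn hT0 hVc
  have hV₁O : V₁ =O[gridFilter] fun _ => (1 : ℝ) :=
    isBigO_gridFilter_of_continuousOn_succ hT0 hVc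
  have haO := isBigO_const_const a (one_ne_zero (α := ℝ)) gridFilter
  have hQ'V₁ : (fun p => Q' p - V₁ p) =o[gridFilter] fun _ => (1 : ℝ) := by
    have h1 : (fun p => h p • (V₁ p * a * V₁ p)) =O[gridFilter] h := by
      simpa using hhO.smul ((hV₁O.mul haO).mul hV₁O)
    have h2 : (fun p => Q' p - V₁ p) =O[gridFilter] h := by
      refine (hQ'.isBigO.add h1).congr_left fun p => ?_
      simp only [hV₁]
      abel
    exact h2.trans_isLittleO hO1
  have hV₁V : (fun p => V₁ p - V (t p)) =o[gridFilter] fun _ => (1 : ℝ) :=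
    sub_isLittleO_one_gridFilter hT0 hVc
  have hQ'V : (fun p => Q' p - V (t p)) =o[gridFilter] fun _ => (1 : ℝ) := by
    simpa using hQ'V₁.add hV₁V
  have hQ'O : Q' =O[gridFilter] fun _ => (1 : ℝ) := by
    simpa using hQ'V.isBigO.add hVO
  refine ⟨fun p => V (t p) - (1 + h p • A (t p))ᵀ * Q' p * (1 + h p • A (t p)), c, ?_, ?_, ?_⟩
  · -- The error is the sum of the error `e₁` of the difference quotient of `V`, the error of the
    -- Gaussian step, the error `e₂` from replacing `Q'` and `V(tₖ₊₁)` by `V(tₖ)` in the terms of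
    -- order `h`, and the quadratic term `e₃`.
    have e₁ := sub_sub_smul_isLittleO_gridFilter hT0 hV hV'
    have e₂ : (fun p => h p • ((A (t p))ᵀ * (Q' p - V (t p)) + (Q' p - V (t p)) * A (t p)
        + ((V₁ p - V (t p)) * a * V₁ p + V (t p) * a * (V₁ p - V (t p)))))
          =o[gridFilter] h := by
      have f1 := hAtO.mul_isLittleO hQ'V
      have f2 := hQ'V.mul_isBigO hAO
      have f3 := (hV₁V.mul_isBigO haO).mul_isBigO hV₁O
      have f4 := (hVO.mul haO).mul_isLittleO hV₁V
      simp only [mul_one] at f1 f2 f3 f4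
      simpa using hhO.smul_isLittleO ((f1.add f2).add (f3.add f4))
    have e₃ : (fun p => h p • h p • ((A (t p))ᵀ * Q' p * A (t p))) =o[gridFilter] h := by
      simpa using hhO.smul_isLittleO (hO1.smul_isBigO ((hAtO.mul hQ'O).mul hAO))
    refine (((e₁.add hQ').add e₂).add e₃).neg_left.congr_left fun p => ?_
    simp only [Matrix.transpose_add, Matrix.transpose_one, Matrix.transpose_smul]
    simp only [add_mul, mul_add, one_mul, mul_one, smul_mul_assoc, mul_smul_comm, sub_mul, mul_sub]
    module
  · have h1 : (fun p => h p * ((a * V₁ p).trace - (a * V (t p)).trace)) =o[gridFilter] h := by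
      have h2 : ContinuousOn (fun t => (a * V t).trace) (Icc 0 T) :=
        (continuous_id.matrix_trace).comp_continuousOn (continuousOn_const.mul hVc)
      simpa using hhO.mul_isLittleO (sub_isLittleO_one_gridFilter hT0 h2)
    refine (hc.add h1).congr_left fun p => ?_
    simp only [hV₁]
    ring
  · filter_upwards [eventually_gridFilter.1 hint, eventually_ne_atTop 0] with N hN hN0
    have key := lintegral_exp_eulerScheme (P := P) (σ := σ)
      (fun k => hB.pastIncrements_le (T / N).toNNReal k)
      (fun k i hi => measurable_pastIncrements B (T / N).toNNReal hi)
      (fun k => hB.measurable_increment _ k) (fun k => hB.indep_pastIncrements _ k)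
      (fun k => hB.map_increment _ k)
      (L := fun k => 1 + (T / N) • A (gridPoint T N k)) (Q := fun k => V (gridPoint T N k))
      (Q' := fun k => Q' (N, k)) (c := fun k => c (N, k)) (N := N)
      (fun k hk z => by
        simp_rw [mulVec_eq_sum_smul]
        exact hN k hk z)
      (fun k _ => rfl) N le_rfl
    simp only [gridPoint_self T hN0] at key
    exact key

end DiscreteFunctional

/-! ### Pathwise convergence of the Euler scheme -/

section Pathwise

variable {n : ℕ}

lemma dotProduct_mulVec_isBigO {ι : Type*} {l : Filter ι} (M : ι → Matrix (Fin n) (Fin n) ℝ)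
    (u v : ι → Fin n → ℝ) :
    (fun i => u i ⬝ᵥ (M i *ᵥ v i)) =O[l] fun i => ‖u i‖ * ‖M i‖ * ‖v i‖ := by
  refine IsBigO.of_bound n (.of_forall fun i => ?_)
  rw [Real.norm_eq_abs, Real.norm_of_nonneg (by positivity)]
  exact abs_dotProduct_mulVec_le _ _ _

lemma ContinuousOn.mulVec {A : ℝ → Matrix (Fin n) (Fin n) ℝ} {z : ℝ → Fin n → ℝ} {s : Set ℝ}
    (hA : ContinuousOn A s) (hz : ContinuousOn z s) : ContinuousOn (fun t => A t *ᵥ z t) s :=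
  (Continuous.matrix_mulVec continuous_fst continuous_snd).comp_continuousOn (hA.prodMk hz)

lemma ContinuousOn.quadContr {A : ℝ → Matrix (Fin n) (Fin n) ℝ} {z : ℝ → Fin n → ℝ} {s : Set ℝ}
    (hA : ContinuousOn A s) (hz : ContinuousOn z s) :
    ContinuousOn (fun t => quadContr (A t) (z t)) s := by
  have h : Continuous fun p : Matrix (Fin n) (Fin n) ℝ × (Fin n → ℝ) => p.2 ⬝ᵥ (p.1 *ᵥ p.2) := by
    fun_prop
  simp only [quadContr_eq_dotProduct]
  exact h.comp_continuousOn (f := fun t => (A t, z t)) (hA.prodMk hz)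

/-- Perturbation of a quadratic form of order `h` and of its argument. -/
lemma quadContr_sub_smul_isLittleO {ι : Type*} {l : Filter ι} {X Y : ι → Fin n → ℝ}
    {C H : ι → Matrix (Fin n) (Fin n) ℝ} {h : ι → ℝ}
    (hdiff : (fun i => X i - Y i) =o[l] fun _ => (1 : ℝ)) (hY : Y =O[l] fun _ => (1 : ℝ))
    (hH : H =O[l] fun _ => (1 : ℝ)) (hC : (fun i => C i - h i • H i) =o[l] h) :
    (fun i => quadContr (C i) (X i) - h i * quadContr (H i) (Y i)) =o[l] h := by
  have hX : X =O[l] fun _ => (1 : ℝ) := by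
    simpa using hdiff.isBigO.add hY
  have hh : h =O[l] h := isBigO_refl _ _
  have e1 : (fun i => X i ⬝ᵥ ((C i - h i • H i) *ᵥ X i)) =o[l] h := by
    refine (dotProduct_mulVec_isBigO _ _ _).trans_isLittleO ?_
    simpa using (hX.norm_left.mul_isLittleO hC.norm_left).mul_isBigO hX.norm_left
  have e2 : (fun i => (X i - Y i) ⬝ᵥ (H i *ᵥ X i)) =o[l] fun _ => (1 : ℝ) := by
    refine (dotProduct_mulVec_isBigO _ _ _).trans_isLittleO ?_
    simpa using (hdiff.norm_left.mul_isBigO hH.norm_left).mul_isBigO hX.norm_left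
  have e3 : (fun i => Y i ⬝ᵥ (H i *ᵥ (X i - Y i))) =o[l] fun _ => (1 : ℝ) := by
    refine (dotProduct_mulVec_isBigO _ _ _).trans_isLittleO ?_
    simpa using (hY.norm_left.mul hH.norm_left).mul_isLittleO hdiff.norm_left
  have e4 := hh.mul_isLittleO (e2.add e3)
  simp only [mul_one] at e4
  refine (e1.add e4).congr_left fun i => ?_
  simp only [quadContr_eq_dotProduct, Matrix.sub_mulVec, Matrix.smul_mulVec, dotProduct_sub,
    sub_dotProduct, dotProduct_smul, Matrix.mulVec_sub, smul_eq_mul]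
  ring

/-- A discrete Gronwall inequality. -/
lemma discrete_gronwall_of_lt {K h δ : ℝ} (hK : 0 ≤ K) (hh : 0 ≤ h) (hδ : 0 ≤ δ) {e : ℕ → ℝ} {N : ℕ}
    (h0 : e 0 = 0) (hstep : ∀ k < N, e (k + 1) ≤ (1 + h * K) * e k + δ * h) :
    ∀ k ≤ N, e k ≤ δ * (k * h) * Real.exp (K * (k * h))
  | 0, _ => by simp [h0]
  | k + 1, hk => by
    have ih := discrete_gronwall_of_lt hK hh hδ h0 hstep k (Nat.le_of_succ_le hk)
    have h1 : 1 + h * K ≤ Real.exp (K * h) := by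
      have := Real.add_one_le_exp (K * h)
      linarith
    have h2 : Real.exp (K * ((k + 1 : ℕ) * h)) = Real.exp (K * h) * Real.exp (K * (k * h)) := by
      rw [← Real.exp_add]; congr 1; push_cast; ring
    have h3 : 1 ≤ Real.exp (K * ((k + 1 : ℕ) * h)) := Real.one_le_exp (by positivity)
    calc e (k + 1) ≤ (1 + h * K) * e k + δ * h := hstep k hk
      _ ≤ (1 + h * K) * (δ * (k * h) * Real.exp (K * (k * h))) + δ * h := by
          gcongr
      _ ≤ Real.exp (K * h) * (δ * (k * h) * Real.exp (K * (k * h))) + δ * h * 1 := by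
          rw [mul_one]
          gcongr
      _ ≤ Real.exp (K * h) * (δ * (k * h) * Real.exp (K * (k * h)))
            + δ * h * Real.exp (K * ((k + 1 : ℕ) * h)) := by
          gcongr
      _ = _ := by
          rw [h2]; push_cast; ring

/-- Since the noise is additive, the Euler scheme converges uniformly on each path: the integral
equation leaves a local error that is `o(h)`. -/
theorem eventually_norm_sub_gridEuler_le {Ω : Type*} {A : ℝ → Matrix (Fin n) (Fin n) ℝ}
    {σ : Matrix (Fin n) (Fin n) ℝ} {T : ℝ} (hT : 0 ≤ T) {B : ℝ≥0 → Ω → Fin n → ℝ}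
    {z : ℝ → Fin n → ℝ} {ω : Ω} (hA : ContinuousOn A (Icc 0 T)) (hz : ContinuousOn z (Icc 0 T))
    (hB0 : B 0 ω = 0)
    (heq : ∀ t ∈ Icc 0 T, z t = (∫ s in (0 : ℝ)..t, A s *ᵥ z s) + σ *ᵥ B t.toNNReal ω)
    {ε : ℝ} (hε : 0 < ε) :
    ∀ᶠ N in atTop, ∀ k ≤ N, ‖z (gridPoint T N k) - gridEuler A σ T B N k ω‖ ≤ ε := by
  obtain ⟨K, hK⟩ := isCompact_Icc.exists_bound_of_continuousOn hA
  have hK0 : 0 ≤ K := (norm_nonneg _).trans (hK 0 (left_mem_Icc.2 hT))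
  have hg : ContinuousOn (fun t => A t *ᵥ z t) (Icc 0 T) := hA.mulVec hz
  set δ : ℝ := ε / (T * Real.exp (K * T) + 1) with hδ
  have hδ0 : 0 < δ := by positivity
  filter_upwards [eventually_gridFilter.1
    (isLittleO_iff.1 (integral_sub_smul_isLittleO_gridFilter hT hg) hδ0), eventually_ne_atTop 0]
    with N hN hN0 k hk
  have hNpos : (0 : ℝ) < N := by positivity
  have hh0 : 0 ≤ T / N := by positivity
  set e : ℕ → Fin n → ℝ := fun k => z (gridPoint T N k) - gridEuler A σ T B N k ω with he
  have he0 : ‖e 0‖ = 0 := by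
    have := heq 0 (left_mem_Icc.2 hT)
    simp [he, gridEuler, eulerScheme, this, hB0]
  have hgp : ∀ k : ℕ, (gridPoint T N k).toNNReal = k * (T / N).toNNReal := fun k => by
    rw [gridPoint, Real.toNNReal_mul (Nat.cast_nonneg k), Real.toNNReal_natCast]
  have hstep : ∀ k < N, ‖e (k + 1)‖ ≤ (1 + T / N * K) * ‖e k‖ + δ * (T / N) := by
    intro k hk
    have hmem := gridPoint_mem hT hk.le
    have hmem' : gridPoint T N (k + 1) ∈ Icc 0 T := gridPoint_mem hT hk
    have hint : ∀ u ∈ Icc 0 T, IntervalIntegrable (fun t => A t *ᵥ z t) volume 0 u :=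
      fun u hu => (hg.mono (Icc_subset_Icc_right hu.2)).intervalIntegrable_of_Icc hu.1
    have hrec : e (k + 1) = e k + (T / N) • (A (gridPoint T N k) *ᵥ e k)
        + ((∫ s in gridPoint T N k..gridPoint T N (k + 1), A s *ᵥ z s)
          - (T / N) • (A (gridPoint T N k) *ᵥ z (gridPoint T N k))) := by
      have h1 := intervalIntegral.integral_interval_sub_left (hint _ hmem') (hint _ hmem)
      have h2 : gridEuler A σ T B N (k + 1) ω
          = gridEuler A σ T B N k ω
            + (T / N) • (A (gridPoint T N k) *ᵥ gridEuler A σ T B N k ω)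
            + (σ *ᵥ B (gridPoint T N (k + 1)).toNNReal ω
              - σ *ᵥ B (gridPoint T N k).toNNReal ω) := by
        rw [hgp, hgp, ← Matrix.mulVec_sub]
        conv_lhs => rw [gridEuler, eulerScheme]
        rw [Matrix.add_mulVec, Matrix.one_mulVec, Matrix.smul_mulVec]
        rfl
      simp only [he]
      rw [h2, ← h1, heq _ hmem', Matrix.mulVec_sub, smul_sub]
      have h3 := eq_sub_of_add_eq' (heq _ hmem).symm
      rw [h3]
      abel
    rw [hrec]
    refine (norm_add_le _ _).trans (add_le_add ?_ ?_)
    · refine (norm_add_le _ _).trans ?_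
      rw [norm_smul, Real.norm_of_nonneg hh0, add_mul, one_mul, mul_assoc]
      gcongr
      exact (Matrix.linfty_opNorm_mulVec _ _).trans
        (mul_le_mul_of_nonneg_right (hK _ hmem) (norm_nonneg _))
    · have := hN k hk
      rwa [Real.norm_of_nonneg hh0] at this
  have hfin := discrete_gronwall_of_lt (e := fun k => ‖e k‖) hK0 hh0 hδ0.le he0 hstep k hk
  have hkT : (k : ℝ) * (T / N) ≤ T := (gridPoint_mem hT hk).2
  refine hfin.trans ?_
  calc δ * (k * (T / N)) * Real.exp (K * (k * (T / N))) ≤ δ * T * Real.exp (K * T) := by gcongr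
    _ = δ * (T * Real.exp (K * T)) := by ring
    _ ≤ δ * (T * Real.exp (K * T) + 1) := by gcongr; linarith
    _ = ε := by rw [hδ]; field_simp

/-- Convergence of the discrete exponents along a path of the equation. -/
theorem tendsto_discrete_functional {Ω : Type*} {A H : ℝ → Matrix (Fin n) (Fin n) ℝ}
    {σ : Matrix (Fin n) (Fin n) ℝ} {T : ℝ} (hT : 0 ≤ T) {B : ℝ≥0 → Ω → Fin n → ℝ}
    {z : ℝ → Fin n → ℝ} {ω : Ω} (hA : ContinuousOn A (Icc 0 T)) (hz : ContinuousOn z (Icc 0 T))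
    (hB0 : B 0 ω = 0)
    (heq : ∀ t ∈ Icc 0 T, z t = (∫ s in (0 : ℝ)..t, A s *ᵥ z s) + σ *ᵥ B t.toNNReal ω)
    (hH : ContinuousOn H (Icc 0 T)) {C : ℕ × ℕ → Matrix (Fin n) (Fin n) ℝ}
    (hC : (fun p => C p - (T / p.1) • H (gridPoint T p.1 p.2)) =o[gridFilter]
      fun p => T / (p.1 : ℝ)) (F : Matrix (Fin n) (Fin n) ℝ) :
    Tendsto (fun N => 1 / 2 * quadContr F (gridEuler A σ T B N N ω)
        + 1 / 2 * ∑ k ∈ Finset.range N, quadContr (C (N, k)) (gridEuler A σ T B N k ω)) atTop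
      (𝓝 (1 / 2 * (∫ t in (0 : ℝ)..T, quadContr (H t) (z t)) + 1 / 2 * quadContr F (z T))) := by
  have hX : ∀ ε > 0, ∀ᶠ N in atTop, ∀ k ≤ N,
      ‖z (gridPoint T N k) - gridEuler A σ T B N k ω‖ ≤ ε := fun ε hε =>
    eventually_norm_sub_gridEuler_le hT hA hz hB0 heq hε
  have hend : Tendsto (fun N => gridEuler A σ T B N N ω) atTop (𝓝 (z T)) := by
    rw [tendsto_iff_norm_sub_tendsto_zero, Metric.tendsto_nhds]
    intro ε hε
    filter_upwards [hX (ε / 2) (by positivity), eventually_ne_atTop 0] with N hN hN0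
    have := hN N le_rfl
    rw [gridPoint_self T hN0] at this
    rw [dist_zero_right, norm_norm, norm_sub_rev]
    linarith
  have hquad : Tendsto (fun N => quadContr F (gridEuler A σ T B N N ω)) atTop
      (𝓝 (quadContr F (z T))) := by
    have : Continuous (quadContr F) :=
      continuous_quadContr.comp (Continuous.prodMk_right F)
    exact (this.tendsto _).comp hend
  suffices hsum : Tendsto (fun N => ∑ k ∈ Finset.range N,
      quadContr (C (N, k)) (gridEuler A σ T B N k ω)) atTop
      (𝓝 (∫ t in (0 : ℝ)..T, quadContr (H t) (z t))) by
    have h := (hquad.const_mul (1 / 2)).add (hsum.const_mul (1 / 2))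
    rwa [add_comm (1 / 2 * quadContr F (z T))] at h
  have hg : ContinuousOn (fun t => quadContr (H t) (z t)) (Icc 0 T) :=
    hH.quadContr hz
  refine tendsto_sum_gridFilter hT hg
    (a := fun p => quadContr (C p) (gridEuler A σ T B p.1 p.2 ω)) ?_
  set X : ℕ × ℕ → Fin n → ℝ := fun p => gridEuler A σ T B p.1 p.2 ω with hXdef
  set Zg : ℕ × ℕ → Fin n → ℝ := fun p => z (gridPoint T p.1 p.2) with hZg
  set Hg : ℕ × ℕ → Matrix (Fin n) (Fin n) ℝ := fun p => H (gridPoint T p.1 p.2) with hHg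
  have hdiff : (fun p => X p - Zg p) =o[gridFilter] fun _ => (1 : ℝ) := by
    refine isLittleO_iff.2 fun ε hε => ?_
    rw [eventually_gridFilter]
    filter_upwards [hX ε hε] with N hN k hk
    rw [norm_sub_rev]
    simpa using hN k hk.le
  have hZO : Zg =O[gridFilter] fun _ => (1 : ℝ) := isBigO_gridFilter_of_continuousOn hT hz
  have hHO : Hg =O[gridFilter] fun _ => (1 : ℝ) := isBigO_gridFilter_of_continuousOn hT hH
  exact quadContr_sub_smul_isLittleO hdiff hZO hHO hC

end Pathwise

/-! ### Passage to the limit in exponential moments -/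

section ExponentialMoments

/-- Exponential moments pass to the almost sure limit if those of some higher order `p > 1` are
bounded. -/
theorem integrable_exp_and_integral_eq_of_tendsto {Ω : Type*} [MeasurableSpace Ω] {P : Measure Ω}
    [IsProbabilityMeasure P] {e : ℕ → Ω → ℝ} {e' : Ω → ℝ} (hmeas : ∀ N, Measurable (e N))
    (hlim : ∀ᵐ ω ∂P, Tendsto (fun N => e N ω) atTop (𝓝 (e' ω)))
    {r : ℕ → ℝ} {r' : ℝ} (hr' : 0 ≤ r') (hr : Tendsto r atTop (𝓝 r'))
    (hmom : ∀ᶠ N in atTop, ∫⁻ ω, ENNReal.ofReal (Real.exp (e N ω)) ∂P = ENNReal.ofReal (r N))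
    {p : ℝ} (hp : 1 < p) {M : ℝ}
    (hbound : ∀ᶠ N in atTop, ∫⁻ ω, ENNReal.ofReal (Real.exp (p * e N ω)) ∂P
      ≤ ENNReal.ofReal M) :
    Integrable (fun ω => Real.exp (e' ω)) P ∧ r' = ∫ ω, Real.exp (e' ω) ∂P := by
  have hae' : AEMeasurable e' P :=
    aemeasurable_of_tendsto_metrizable_ae atTop (fun N => (hmeas N).aemeasurable) hlim
  have hrE : Tendsto (fun N => ∫⁻ ω, ENNReal.ofReal (Real.exp (e N ω)) ∂P) atTop
      (𝓝 (ENNReal.ofReal r')) :=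
    (ENNReal.tendsto_ofReal hr).congr' (hmom.mono fun N hN => hN.symm)
  have hupper : ∫⁻ ω, ENNReal.ofReal (Real.exp (e' ω)) ∂P ≤ ENNReal.ofReal r' := by
    rw [← hrE.liminf_eq]
    refine le_trans (lintegral_mono_ae ?_) (lintegral_liminf_le fun N => by fun_prop)
    filter_upwards [hlim] with ω hω
    have : Tendsto (fun N => ENNReal.ofReal (Real.exp (e N ω))) atTop
        (𝓝 (ENNReal.ofReal (Real.exp (e' ω)))) :=
      ENNReal.tendsto_ofReal ((Real.continuous_exp.tendsto _).comp hω)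
    exact this.liminf_eq.ge
  -- Truncate at the level `exp κ`; the remainder is at most `exp ((1 - p) κ)` times the moment of
  -- order `p`.
  have htrunc : ∀ κ : ℝ, ENNReal.ofReal r' ≤ (∫⁻ ω, ENNReal.ofReal (Real.exp (e' ω)) ∂P)
      + ENNReal.ofReal (Real.exp ((1 - p) * κ)) * ENNReal.ofReal M := by
    intro κ
    have hbc : Tendsto (fun N => ∫⁻ ω, ENNReal.ofReal (min (Real.exp (e N ω)) (Real.exp κ)) ∂P)
        atTop (𝓝 (∫⁻ ω, ENNReal.ofReal (min (Real.exp (e' ω)) (Real.exp κ)) ∂P)) := by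
      refine tendsto_lintegral_of_dominated_convergence (fun _ => ENNReal.ofReal (Real.exp κ))
        (fun N => by fun_prop) (fun N => .of_forall fun ω => ?_) (by simp) ?_
      · exact ENNReal.ofReal_le_ofReal (min_le_right _ _)
      · filter_upwards [hlim] with ω hω
        exact ENNReal.tendsto_ofReal
          (((Real.continuous_exp.tendsto _).comp hω).min tendsto_const_nhds)
    refine (le_of_tendsto_of_tendsto hrE (hbc.add_const
      (ENNReal.ofReal (Real.exp ((1 - p) * κ)) * ENNReal.ofReal M)) ?_).trans ?_
    · filter_upwards [hbound] with N hN
      calc ∫⁻ ω, ENNReal.ofReal (Real.exp (e N ω)) ∂P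
          ≤ ∫⁻ ω, (ENNReal.ofReal (min (Real.exp (e N ω)) (Real.exp κ))
            + ENNReal.ofReal (Real.exp ((1 - p) * κ)) * ENNReal.ofReal (Real.exp (p * e N ω)))
              ∂P := by
            refine lintegral_mono fun ω => ?_
            rw [← ENNReal.ofReal_mul (Real.exp_pos _).le, ← ENNReal.ofReal_add (by positivity)
              (by positivity), ← Real.exp_add]
            refine ENNReal.ofReal_le_ofReal ?_
            rcases le_total (e N ω) κ with h | h
            · rw [min_eq_left (Real.exp_le_exp.2 h)]
              linarith [Real.exp_pos ((1 - p) * κ + p * e N ω)]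
            · have h1 : Real.exp (e N ω) ≤ Real.exp ((1 - p) * κ + p * e N ω) :=
                Real.exp_le_exp.2 (by nlinarith)
              have h2 : 0 ≤ min (Real.exp (e N ω)) (Real.exp κ) := by positivity
              linarith
        _ ≤ _ := by
            rw [lintegral_add_left (by fun_prop), lintegral_const_mul _ (by fun_prop)]
            gcongr
    · gcongr
      exact min_le_left _ _
  have hlower : ENNReal.ofReal r' ≤ ∫⁻ ω, ENNReal.ofReal (Real.exp (e' ω)) ∂P := by
    have h1 : Tendsto (fun κ : ℝ => Real.exp ((1 - p) * κ)) atTop (𝓝 0) :=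
      Real.tendsto_exp_atBot.comp (tendsto_id.const_mul_atTop_of_neg (by linarith))
    have h2 := ENNReal.Tendsto.mul_const (ENNReal.tendsto_ofReal h1)
      (Or.inr (ENNReal.ofReal_ne_top (r := M)))
    have h3 := h2.const_add (∫⁻ ω, ENNReal.ofReal (Real.exp (e' ω)) ∂P)
    rw [ENNReal.ofReal_zero, zero_mul, add_zero] at h3
    exact ge_of_tendsto' h3 htrunc
  have heq := le_antisymm hupper hlower
  have hpos : ∀ᵐ ω ∂P, 0 ≤ Real.exp (e' ω) := .of_forall fun ω => (Real.exp_pos _).le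
  have hsm : AEStronglyMeasurable (fun ω => Real.exp (e' ω)) P :=
    (Real.measurable_exp.comp_aemeasurable hae').aestronglyMeasurable
  refine ⟨⟨hsm, ?_⟩, ?_⟩
  · rw [hasFiniteIntegral_iff_ofReal hpos, heq]
    exact ENNReal.ofReal_lt_top
  · rw [integral_eq_lintegral_of_nonneg_ae hpos hsm, heq, ENNReal.toReal_ofReal hr']

end ExponentialMoments

/-! ### The coefficients along the instanton -/

section Coefficients

variable {n : ℕ}

lemma hessianMat_apply_eq {g : (Fin n → ℝ) → ℝ} (hg : ContDiff ℝ 2 g) (x : Fin n → ℝ)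
    (i j : Fin n) :
    hessianMat g x i j = fderiv ℝ (fderiv ℝ g) x (Pi.single i 1) (Pi.single j 1) := by
  have h : DifferentiableAt ℝ (fderiv ℝ g) x :=
    (hg.fderiv_right (m := 1) (by norm_num)).differentiable (by norm_num) x
  rw [hessianMat, Matrix.of_apply, fderiv_clm_apply h (differentiableAt_const _)]
  simp

lemma isSymm_hessianMat {g : (Fin n → ℝ) → ℝ} (hg : ContDiff ℝ 2 g) (x : Fin n → ℝ) :
    (hessianMat g x).IsSymm := by
  refine Matrix.IsSymm.ext fun i j => ?_
  rw [hessianMat_apply_eq hg, hessianMat_apply_eq hg]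
  exact (hg.contDiffAt.isSymmSndFDerivAt (by simp)) _ _

lemma continuous_hessianMat {g : (Fin n → ℝ) → ℝ} (hg : ContDiff ℝ 2 g) :
    Continuous (hessianMat g) := by
  refine continuous_pi fun i => continuous_pi fun j => ?_
  simp_rw [hessianMat_apply_eq hg]
  have h : Continuous (fderiv ℝ (fderiv ℝ g)) :=
    (hg.fderiv_right (m := 1) (by norm_num)).continuous_fderiv (by norm_num)
  fun_prop

variable {b : (Fin n → ℝ) → Fin n → ℝ}

lemma ContDiff.dotProduct_const (hb : ContDiff ℝ 2 b) (θ : Fin n → ℝ) :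
    ContDiff ℝ 2 fun y => b y ⬝ᵥ θ := by
  simp only [dotProduct]
  exact ContDiff.sum fun i _ => (contDiff_pi.1 hb i).mul contDiff_const

lemma driftHessian_eq_sum (hb : ContDiff ℝ 2 b) (x θ : Fin n → ℝ) :
    driftHessian b x θ = ∑ k, θ k • hessianMat (fun y => b y k) x := by
  have hbk : ∀ k, ContDiff ℝ 2 fun y => b y k := contDiff_pi.1 hb
  have hd : ∀ k, Differentiable ℝ (fderiv ℝ fun y => b y k) := fun k =>
    ((hbk k).fderiv_right (m := 1) (by norm_num)).differentiable (by norm_num)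
  have h1 : (fderiv ℝ fun y => b y ⬝ᵥ θ) = fun y => ∑ k, θ k • fderiv ℝ (fun y => b y k) y := by
    funext y
    simp only [dotProduct]
    rw [fderiv_fun_sum fun k _ => (((hbk k).differentiable (by norm_num)) y).mul_const _]
    refine Finset.sum_congr rfl fun k _ => ?_
    rw [fderiv_mul_const (((hbk k).differentiable (by norm_num)) y)]
  ext i j
  rw [driftHessian, hessianMat_apply_eq (hb.dotProduct_const θ), h1,
    fderiv_fun_sum fun k _ => (hd k x).fun_const_smul (θ k)]
  simp only [Matrix.sum_apply, Matrix.smul_apply, sum_apply]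
  refine Finset.sum_congr rfl fun k _ => ?_
  rw [hessianMat_apply_eq (hbk k), fderiv_fun_const_smul (hd k x)]
  rfl

lemma isSymm_driftHessian (hb : ContDiff ℝ 2 b) (x θ : Fin n → ℝ) :
    (driftHessian b x θ).IsSymm :=
  isSymm_hessianMat (hb.dotProduct_const θ) x

lemma continuousOn_driftHessian (hb : ContDiff ℝ 2 b) {φ θ : ℝ → Fin n → ℝ} {s : Set ℝ}
    (hφ : ContinuousOn φ s) (hθ : ContinuousOn θ s) :
    ContinuousOn (fun t => driftHessian b (φ t) (θ t)) s := by
  simp_rw [driftHessian_eq_sum hb]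
  refine continuousOn_finsetSum _ fun k _ => ?_
  exact ((continuous_apply k).comp_continuousOn hθ).smul
    ((continuous_hessianMat (contDiff_pi.1 hb k)).comp_continuousOn hφ)

lemma continuous_jacobianMat (hb : ContDiff ℝ 2 b) : Continuous (jacobianMat b) := by
  refine continuous_pi fun i => continuous_pi fun j => ?_
  have h : Continuous (fderiv ℝ fun y => b y i) :=
    (contDiff_pi.1 hb i).continuous_fderiv (by norm_num)
  simp only [jacobianMat, Matrix.of_apply]
  fun_prop

end Coefficients

/-! ### Solutions of the Riccati equation -/

section Riccati

variable {n : ℕ} {a : Matrix (Fin n) (Fin n) ℝ} {T : ℝ} {A H W : ℝ → Matrix (Fin n) (Fin n) ℝ}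

lemma hasDerivWithinAt_matrix {V : ℝ → Matrix (Fin n) (Fin n) ℝ} {V' : Matrix (Fin n) (Fin n) ℝ}
    {s : Set ℝ} {t : ℝ} (h : ∀ i j, HasDerivWithinAt (fun u => V u i j) (V' i j) s t) :
    HasDerivWithinAt V V' s t :=
  hasDerivWithinAt_pi.2 fun i => hasDerivWithinAt_pi.2 fun j => h i j

lemma HasDerivWithinAt.matrix_transpose {V : ℝ → Matrix (Fin n) (Fin n) ℝ}
    {V' : Matrix (Fin n) (Fin n) ℝ} {s : Set ℝ} {t : ℝ} (h : HasDerivWithinAt V V' s t) :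
    HasDerivWithinAt (fun u => (V u)ᵀ) V'ᵀ s t :=
  hasDerivWithinAt_matrix fun i j => hasDerivWithinAt_pi.1 (hasDerivWithinAt_pi.1 h j) i

/-- The skew part `D = W - Wᵀ` of a solution of a Riccati equation with symmetric coefficients
solves the linear equation `D' = -(Aᵀ D + D A + D a W + Wᵀ a D)`; it vanishes with its final
value. -/
lemma isSymm_of_riccati (ha : a.IsSymm) (hA : ContinuousOn A (Icc 0 T))
    (hH : ∀ t ∈ Icc 0 T, (H t).IsSymm)
    (hW : ∀ t ∈ Icc 0 T, HasDerivWithinAt W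
      (-H t - (A t)ᵀ * W t - W t * A t - W t * a * W t) (Icc 0 T) t)
    (hfin : (W T).IsSymm) : ∀ t ∈ Icc 0 T, (W t).IsSymm := by
  have hWc : ContinuousOn W (Icc 0 T) := fun t ht => (hW t ht).continuousWithinAt
  have hT' : Continuous fun M : Matrix (Fin n) (Fin n) ℝ => Mᵀ := continuous_id.matrix_transpose
  have hWt : ContinuousOn (fun t => (W t)ᵀ) (Icc 0 T) := hT'.comp_continuousOn hWc
  have hAt : ContinuousOn (fun t => (A t)ᵀ) (Icc 0 T) := hT'.comp_continuousOn hA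
  obtain ⟨K₁, hK₁⟩ := isCompact_Icc.exists_bound_of_continuousOn
    (hAt.add (hWt.mul (continuousOn_const (c := a))))
  obtain ⟨K₂, hK₂⟩ := isCompact_Icc.exists_bound_of_continuousOn
    (hA.add ((continuousOn_const (c := a)).mul hWc))
  let v : ℝ → Matrix (Fin n) (Fin n) ℝ → Matrix (Fin n) (Fin n) ℝ := fun t D =>
    -(((A t)ᵀ + (W t)ᵀ * a) * D + D * (A t + a * W t))
  have hlip : ∀ t ∈ Ioc 0 T, LipschitzOnWith (K₁ + K₂).toNNReal (v t) univ := by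
    intro t ht
    have ht' := Ioc_subset_Icc_self ht
    refine LipschitzOnWith.of_dist_le' fun D _ D' _ => ?_
    rw [dist_eq_norm, dist_eq_norm]
    have : v t D - v t D' = -(((A t)ᵀ + (W t)ᵀ * a) * (D - D') + (D - D') * (A t + a * W t)) := by
      simp only [v]
      noncomm_ring
    rw [this, norm_neg, add_mul K₁]
    refine (norm_add_le _ _).trans (add_le_add ?_ ?_)
    · exact (norm_mul_le _ _).trans (mul_le_mul_of_nonneg_right (hK₁ t ht') (norm_nonneg _))
    · refine (norm_mul_le _ _).trans ?_
      rw [mul_comm]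
      exact mul_le_mul_of_nonneg_right (hK₂ t ht') (norm_nonneg _)
  have hD : ∀ t ∈ Icc 0 T, HasDerivWithinAt (fun t => W t - (W t)ᵀ) (v t (W t - (W t)ᵀ))
      (Icc 0 T) t := by
    intro t ht
    have hder := (hW t ht).fun_sub (hW t ht).matrix_transpose
    refine hder.congr_deriv ?_
    simp only [v, Matrix.transpose_sub, Matrix.transpose_neg, Matrix.transpose_mul,
      Matrix.transpose_transpose, ha.eq, (hH t ht).eq]
    noncomm_ring
  have huniq := ODE_solution_unique_of_mem_Icc_left (a := 0) (b := T) (v := v)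
    (s := fun _ => univ) (f := fun t => W t - (W t)ᵀ) (g := fun _ => 0) hlip
    (hWc.sub hWt)
    (fun t ht => (hD t (Ioc_subset_Icc_self ht)).mono_of_mem_nhdsWithin
      (Icc_mem_nhdsLE_of_mem ht))
    (fun _ _ => mem_univ _) continuousOn_const
    (fun t _ => by simpa [v] using hasDerivWithinAt_const t (Iic t) (0 : Matrix (Fin n) (Fin n) ℝ))
    (fun _ _ => mem_univ _) (by simp [hfin.eq])
  intro t ht
  exact (sub_eq_zero.1 (huniq ht)).symm

end Riccati

/-! ### The exponential moment and the Riccati equation -/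

section Main

variable {n : ℕ} {Ω : Type*} [MeasurableSpace Ω] {P : Measure Ω}
  {B : ℝ≥0 → Ω → Fin n → ℝ} {σ : Matrix (Fin n) (Fin n) ℝ} {T : ℝ}
  {A H W : ℝ → Matrix (Fin n) (Fin n) ℝ}

/-- The exponent of the exponential moment along the Euler scheme, with discrete running costs
`C (N, k)` and final cost `F`. -/
noncomputable def discreteExponent (A : ℝ → Matrix (Fin n) (Fin n) ℝ)
    (σ : Matrix (Fin n) (Fin n) ℝ) (T : ℝ) (B : ℝ≥0 → Ω → Fin n → ℝ)
    (F : Matrix (Fin n) (Fin n) ℝ) (C : ℕ × ℕ → Matrix (Fin n) (Fin n) ℝ) (N : ℕ) (ω : Ω) : ℝ :=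
  1 / 2 * quadContr F (gridEuler A σ T B N N ω)
    + 1 / 2 * ∑ k ∈ Finset.range N, quadContr (C (N, k)) (gridEuler A σ T B N k ω)

lemma measurable_discreteExponent (hB : IsWienerProcess P B)
    (F : Matrix (Fin n) (Fin n) ℝ) (C : ℕ × ℕ → Matrix (Fin n) (Fin n) ℝ) (N : ℕ) :
    Measurable (discreteExponent A σ T B F C N) := by
  have h : ∀ k, Measurable (gridEuler A σ T B N k) := fun k =>
    measurable_eulerScheme _ σ fun i _ => hB.measurable_increment _ i
  unfold discreteExponent
  fun_prop

variable [IsProbabilityMeasure P]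

/-- Some moment of order `p > 1` of the discrete exponentials stays bounded. The reason is that
`V = W + exp (-λ t)` is a strict supersolution of the Riccati equation for large `λ`, hence also a
supersolution of the equation with data `p H` and `p W(T)` if `p` is close to one. -/
theorem exists_moment_bound (hB : IsWienerProcess P B) (hT : 0 < T)
    (hA : ContinuousOn A (Icc 0 T)) (hH : ContinuousOn H (Icc 0 T))
    (hWsymm : ∀ t ∈ Icc 0 T, (W t).IsSymm)
    (hW : ∀ t ∈ Icc 0 T, HasDerivWithinAt W
      (-H t - (A t)ᵀ * W t - W t * A t - W t * (σ * σᵀ) * W t) (Icc 0 T) t)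
    {C : ℕ × ℕ → Matrix (Fin n) (Fin n) ℝ}
    (hC : (fun p => C p - (T / p.1) • H (gridPoint T p.1 p.2)) =o[gridFilter]
      fun p => T / (p.1 : ℝ)) :
    ∃ p : ℝ, 1 < p ∧ ∃ M : ℝ, ∀ᶠ N in atTop,
      ∫⁻ ω, ENNReal.ofReal (Real.exp (p * discreteExponent A σ T B (W T) C N ω)) ∂P
        ≤ ENNReal.ofReal M := by
  have hWc : ContinuousOn W (Icc 0 T) := fun t ht => (hW t ht).continuousWithinAt
  have hAt : ContinuousOn (fun t => (A t)ᵀ) (Icc 0 T) :=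
    continuous_id.matrix_transpose.comp_continuousOn hA
  set a := σ * σᵀ with ha
  have hca : ContinuousOn (fun _ : ℝ => a) (Icc 0 T) := continuousOn_const
  obtain ⟨K, hK⟩ := isCompact_Icc.exists_bound_of_continuousOn
    (((hAt.add hA).add (hWc.mul hca)).add (hca.mul hWc))
  obtain ⟨KH, hKH⟩ := isCompact_Icc.exists_bound_of_continuousOn hH
  have hKH0 : 0 ≤ KH := (norm_nonneg _).trans (hKH 0 (left_mem_Icc.2 hT.le))
  have hK0 : 0 ≤ K := (norm_nonneg _).trans (hK 0 (left_mem_Icc.2 hT.le))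
  set L : ℝ := n * (K + ‖a‖) + 2 with hL
  have hL0 : 0 < L := by positivity
  set ε : ℝ := Real.exp (-L * T) with hε
  have hε0 : 0 < ε := Real.exp_pos _
  set ρ : ℝ := ε / (n * (KH + ‖W T‖) + 1) with hρ
  have hρ0 : 0 < ρ := by positivity
  have hρmul : ρ * (n * (KH + ‖W T‖)) ≤ ε := by
    rw [hρ, div_mul_eq_mul_div, div_le_iff₀ (by positivity)]
    nlinarith
  have hρH : ρ * (n * KH) ≤ ε := le_trans (by gcongr; simp) hρmul
  have hρF : ρ * (n * ‖W T‖) ≤ ε := le_trans (by gcongr; simpa using hKH0) hρmul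
  set δ : ℝ → ℝ := fun t => Real.exp (-L * t) with hδ
  have hδε : ∀ t ∈ Icc 0 T, ε ≤ δ t ∧ δ t ≤ 1 := fun t ht => by
    refine ⟨Real.exp_le_exp.2 ?_, Real.exp_le_one_iff.2 ?_⟩ <;> nlinarith [ht.1, ht.2]
  have hδd : ∀ t, HasDerivAt δ (-L * δ t) t := fun t => by
    have := ((hasDerivAt_id t).const_mul (-L)).exp
    simpa [hδ, mul_comm] using this
  set V : ℝ → Matrix (Fin n) (Fin n) ℝ := fun t => W t + δ t • 1 with hV
  set V' : ℝ → Matrix (Fin n) (Fin n) ℝ := fun t =>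
    (-H t - (A t)ᵀ * W t - W t * A t - W t * a * W t) + (-L * δ t) • 1 with hV'
  have hVd : ∀ t ∈ Icc 0 T, HasDerivWithinAt V (V' t) (Icc 0 T) t := fun t ht =>
    (hW t ht).fun_add ((hδd t).hasDerivWithinAt.smul_const 1)
  have hδc : Continuous δ := by fun_prop
  have hV'c : ContinuousOn V' (Icc 0 T) :=
    ((((hH.neg.sub (hAt.mul hWc)).sub (hWc.mul hA)).sub ((hWc.mul hca).mul hWc))).add
      (((continuous_const.mul hδc).smul continuous_const).continuousOn)
  have hVsymm : ∀ t ∈ Icc 0 T, (V t).IsSymm := fun t ht =>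
    (hWsymm t ht).add (Matrix.isSymm_one.smul _)
  obtain ⟨CV, cV, hCV, hcV, hint⟩ := exists_discrete_functional hB σ hT hA hVsymm hVd hV'c
  refine ⟨1 + ρ, by linarith, Real.exp (1 / 2 * ((∫ t in (0 : ℝ)..T, (a * V t).trace) + 1)), ?_⟩
  -- The running costs of `V` dominate `1 + ρ` times those of `W`.
  have hdom : ∀ᶠ q in gridFilter, ∀ z, (1 + ρ) * quadContr (C q) z ≤ quadContr (CV q) z := by
    have hR := hCV.sub (hC.const_smul_left (1 + ρ))
    filter_upwards [isLittleO_iff.1 hR (c := ε / (n + 1)) (by positivity),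
      eventually_lt_gridFilter] with q hq hlt z
    set t := gridPoint T q.1 q.2 with ht
    have hmem : t ∈ Icc 0 T := gridPoint_mem hT.le hlt.le
    have hh : 0 ≤ T / (q.1 : ℝ) := by positivity
    rw [Real.norm_of_nonneg hh] at hq
    set h := T / (q.1 : ℝ) with hhdef
    set R := CV q - h • (-(V' t + (A t)ᵀ * V t + V t * A t + V t * a * V t))
      - (1 + ρ) • (C q - h • H t) with hRdef
    have hRle : ‖R‖ ≤ ε / (n + 1) * h := hq
    set M := (A t)ᵀ + A t + W t * a + a * W t with hM
    have hsplit : CV q - (1 + ρ) • C q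
        = h • ((L * δ t) • 1 - δ t • (M + δ t • a) - ρ • H t) + R := by
      simp only [hRdef, hV, hV', hM]
      simp only [mul_add, add_mul, mul_smul_comm, smul_mul_assoc, mul_one, one_mul]
      module
    rw [← sub_nonneg, ← quadContr_smul, ← quadContr_sub, hsplit]
    simp only [quadContr_add, quadContr_sub, quadContr_smul, quadContr_one]
    have hz : 0 ≤ z ⬝ᵥ z := Finset.sum_nonneg fun i _ => mul_self_nonneg (z i)
    have b1 : quadContr M z + δ t * quadContr a z ≤ n * (K + ‖a‖) * (z ⬝ᵥ z) := by
      have h1 := (le_abs_self _).trans (abs_quadContr_le_dotProduct M z)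
      have h2 := abs_quadContr_le_dotProduct a z
      have h3 : δ t * quadContr a z ≤ |quadContr a z| := by
        refine (le_abs_self _).trans ?_
        rw [abs_mul, abs_of_pos (hε0.trans_le (hδε t hmem).1)]
        exact mul_le_of_le_one_left (abs_nonneg _) (hδε t hmem).2
      have h4 : (n : ℝ) * ‖M‖ * (z ⬝ᵥ z) ≤ n * K * (z ⬝ᵥ z) := by
        gcongr
        exact hK t hmem
      linarith
    have b2 : ρ * quadContr (H t) z ≤ ε * (z ⬝ᵥ z) := by
      have h1 := (le_abs_self _).trans (abs_quadContr_le_dotProduct (H t) z)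
      calc ρ * quadContr (H t) z ≤ ρ * (n * KH * (z ⬝ᵥ z)) := by
            gcongr
            refine h1.trans ?_
            gcongr
            exact hKH t hmem
        _ = ρ * (n * KH) * (z ⬝ᵥ z) := by ring
        _ ≤ _ := by gcongr
    have b3 : -(h * (ε * (z ⬝ᵥ z))) ≤ quadContr R z := by
      have h1 := (neg_abs_le _).trans' (neg_le_neg (abs_quadContr_le_dotProduct R z))
      refine le_trans (neg_le_neg ?_) h1
      calc n * ‖R‖ * (z ⬝ᵥ z) ≤ n * (ε / (n + 1) * h) * (z ⬝ᵥ z) := by gcongr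
        _ = h * (ε * (n / (n + 1)) * (z ⬝ᵥ z)) := by ring
        _ ≤ h * (ε * 1 * (z ⬝ᵥ z)) := by
            gcongr
            rw [div_le_one (by positivity)]
            linarith
        _ = _ := by ring
    have b4 : 2 * (ε * (z ⬝ᵥ z)) ≤ L * δ t * (z ⬝ᵥ z)
        - δ t * (quadContr M z + δ t * quadContr a z) := by
      have h1 := mul_le_mul_of_nonneg_left b1 (hε0.le.trans (hδε t hmem).1)
      have h2 := mul_le_mul_of_nonneg_right (hδε t hmem).1 hz
      calc 2 * (ε * (z ⬝ᵥ z)) ≤ 2 * (δ t * (z ⬝ᵥ z)) := by linarith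
        _ = L * δ t * (z ⬝ᵥ z) - δ t * (n * (K + ‖a‖) * (z ⬝ᵥ z)) := by rw [hL]; ring
        _ ≤ _ := by linarith
    have b5 : 0 ≤ h * (L * δ t * (z ⬝ᵥ z) - δ t * (quadContr M z + δ t * quadContr a z)
        - ρ * quadContr (H t) z - ε * (z ⬝ᵥ z)) := mul_nonneg hh (by linarith)
    linarith
  have hfinal : ∀ z, (1 + ρ) * quadContr (W T) z ≤ quadContr (V T) z := by
    intro z
    have hz : 0 ≤ z ⬝ᵥ z := Finset.sum_nonneg fun i _ => mul_self_nonneg (z i)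
    have h1 := (le_abs_self _).trans (abs_quadContr_le_dotProduct (W T) z)
    have h2 : ρ * quadContr (W T) z ≤ ε * (z ⬝ᵥ z) := by
      calc ρ * quadContr (W T) z ≤ ρ * (n * ‖W T‖ * (z ⬝ᵥ z)) := by gcongr
        _ = ρ * (n * ‖W T‖) * (z ⬝ᵥ z) := by ring
        _ ≤ _ := by gcongr
    simp only [hV, quadContr_add, quadContr_smul, quadContr_one]
    have : δ T = ε := rfl
    rw [this]
    linarith
  have hVc : ContinuousOn V (Icc 0 T) := fun t ht => (hVd t ht).continuousWithinAt
  have htr : ContinuousOn (fun t => (a * V t).trace) (Icc 0 T) :=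
    (continuous_id.matrix_trace).comp_continuousOn (hca.mul hVc)
  have hsum := tendsto_sum_gridFilter hT.le htr hcV
  filter_upwards [hint, eventually_gridFilter.1 hdom,
    hsum.eventually (gt_mem_nhds (lt_add_one _))] with N hN hdomN hsumN
  calc _ ≤ ∫⁻ ω, ENNReal.ofReal (Real.exp (discreteExponent A σ T B (V T) CV N ω)) ∂P := by
        refine lintegral_mono fun ω => ENNReal.ofReal_le_ofReal (Real.exp_le_exp.2 ?_)
        have h1 := hfinal (gridEuler A σ T B N N ω)
        have h2 : (1 + ρ) * ∑ k ∈ Finset.range N, quadContr (C (N, k)) (gridEuler A σ T B N k ω)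
            ≤ ∑ k ∈ Finset.range N, quadContr (CV (N, k)) (gridEuler A σ T B N k ω) := by
          rw [Finset.mul_sum]
          exact Finset.sum_le_sum fun k hk => hdomN k (Finset.mem_range.1 hk) _
        simp only [discreteExponent]
        linarith
    _ = _ := hN
    _ ≤ _ := ENNReal.ofReal_le_ofReal (Real.exp_le_exp.2 (by linarith))

/-- Exponential moments of quadratic functionals of the Gaussian process `dZ = A Z dt + σ dB`,
`Z₀ = 0`, in terms of a solution of the Riccati equation. -/
theorem integrable_exp_and_exp_integral_trace_eq (hB : IsWienerProcess P B) (hT : 0 < T)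
    (hA : ContinuousOn A (Icc 0 T)) (hH : ContinuousOn H (Icc 0 T))
    (hWsymm : ∀ t ∈ Icc 0 T, (W t).IsSymm)
    (hW : ∀ t ∈ Icc 0 T, HasDerivWithinAt W
      (-H t - (A t)ᵀ * W t - W t * A t - W t * (σ * σᵀ) * W t) (Icc 0 T) t)
    {Z : ℝ → Ω → Fin n → ℝ} (hZ : IsLinearSDESolution P A σ T 0 B Z) :
    Integrable (fun ω => Real.exp (1 / 2 * (∫ t in (0 : ℝ)..T, quadContr (H t) (Z t ω))
        + 1 / 2 * quadContr (W T) (Z T ω))) P ∧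
      Real.exp (1 / 2 * ∫ t in (0 : ℝ)..T, (σ * σᵀ * W t).trace)
        = ∫ ω, Real.exp (1 / 2 * (∫ t in (0 : ℝ)..T, quadContr (H t) (Z t ω))
          + 1 / 2 * quadContr (W T) (Z T ω)) ∂P := by
  have hWc : ContinuousOn W (Icc 0 T) := fun t ht => (hW t ht).continuousWithinAt
  have hAt : ContinuousOn (fun t => (A t)ᵀ) (Icc 0 T) :=
    continuous_id.matrix_transpose.comp_continuousOn hA
  have hca : ContinuousOn (fun _ : ℝ => σ * σᵀ) (Icc 0 T) := continuousOn_const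
  have hW'c : ContinuousOn (fun t => -H t - (A t)ᵀ * W t - W t * A t - W t * (σ * σᵀ) * W t)
      (Icc 0 T) :=
    ((hH.neg.sub (hAt.mul hWc)).sub (hWc.mul hA)).sub ((hWc.mul hca).mul hWc)
  obtain ⟨C, c, hC, hc, hint⟩ := exists_discrete_functional hB σ hT hA hWsymm hW hW'c
  -- By the Riccati equation the running costs of `W` are those of `H`.
  have hCH : (fun p => C p - (T / p.1) • H (gridPoint T p.1 p.2)) =o[gridFilter]
      fun p => T / (p.1 : ℝ) := by
    refine hC.congr_left fun p => congrArg (fun M => C p - (T / (p.1 : ℝ)) • M) ?_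
    beta_reduce
    abel
  obtain ⟨p, hp, M, hM⟩ := exists_moment_bound hB hT hA hH hWsymm hW hCH
  have htr : ContinuousOn (fun t => (σ * σᵀ * W t).trace) (Icc 0 T) :=
    (continuous_id.matrix_trace).comp_continuousOn (hca.mul hWc)
  have hB0 : ∀ᵐ ω ∂P, B 0 ω = 0 := by
    have : ∀ᵐ ω ∂P, ∀ i, B 0 ω i = 0 :=
      ae_all_iff.2 fun i => (hB.brownian i).eval_zero_ae_eq_zero
    filter_upwards [this] with ω hω using funext hω
  refine integrable_exp_and_integral_eq_of_tendsto
    (e := fun N => discreteExponent A σ T B (W T) C N)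
    (r := fun N => Real.exp (1 / 2 * ∑ k ∈ Finset.range N, c (N, k)))
    (fun N => measurable_discreteExponent hB _ _ N) ?_ (Real.exp_pos _).le
    ((Real.continuous_exp.tendsto _).comp ((tendsto_sum_gridFilter hT.le htr hc).const_mul _))
    hint hp hM
  filter_upwards [hZ.continuous_paths, hZ.integral_eq, hB0] with ω hω heq hB0ω
  simp only [zero_add] at heq
  exact tendsto_discrete_functional (z := fun t => Z t ω) hT.le hA hω hB0ω heq hH hCH (W T)

end Main

theorem proposition2p2 {n : ℕ} (σ : Matrix (Fin n) (Fin n) ℝ)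
    (b : (Fin n → ℝ) → (Fin n → ℝ)) (hb : ContDiff ℝ 2 b)
    (f : (Fin n → ℝ) → ℝ) (hf : ContDiff ℝ 2 f)
    (T : ℝ) (hT : 0 < T) (x : Fin n → ℝ)
    (φ θ : ℝ → (Fin n → ℝ)) (hφθ : IsInstanton (σ * σᵀ) b f T x φ θ)
    (W : ℝ → Matrix (Fin n) (Fin n) ℝ) (hW : IsRiccatiSolution (σ * σᵀ) b f T φ θ W)
    {Ω : Type*} [MeasurableSpace Ω] (P : Measure Ω) [IsProbabilityMeasure P]
    (B : ℝ≥0 → Ω → (Fin n → ℝ)) (hB : IsWienerProcess P B)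
    (Z : ℝ → Ω → (Fin n → ℝ))
    (hZ : IsLinearSDESolution P (fun t => jacobianMat b (φ t)) σ T 0 B Z) :
    Integrable (fun ω => Real.exp
      (1 / 2 * (∫ t in (0 : ℝ)..T, quadContr (driftHessian b (φ t) (θ t)) (Z t ω))
        + 1 / 2 * quadContr (hessianMat f (φ T)) (Z T ω))) P ∧
    prefactor (σ * σᵀ) T W = ∫ ω, Real.exp
      (1 / 2 * (∫ t in (0 : ℝ)..T, quadContr (driftHessian b (φ t) (θ t)) (Z t ω))
        + 1 / 2 * quadContr (hessianMat f (φ T)) (Z T ω)) ∂P := by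

  have hφ : ContinuousOn φ (Icc 0 T) := fun t ht => (hφθ.deriv_path t ht).continuousWithinAt
  have hθ : ContinuousOn θ (Icc 0 T) := fun t ht => (hφθ.deriv_momentum t ht).continuousWithinAt
  have hA : ContinuousOn (fun t => jacobianMat b (φ t)) (Icc 0 T) :=
    (continuous_jacobianMat hb).comp_continuousOn hφ
  have hH : ContinuousOn (fun t => driftHessian b (φ t) (θ t)) (Icc 0 T) :=
    continuousOn_driftHessian hb hφ hθ
  have hWd : ∀ t ∈ Icc 0 T, HasDerivWithinAt W (-driftHessian b (φ t) (θ t)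
      - (jacobianMat b (φ t))ᵀ * W t - W t * jacobianMat b (φ t) - W t * (σ * σᵀ) * W t)
      (Icc 0 T) t := fun t ht => hasDerivWithinAt_matrix fun i j => hW.deriv_entry t ht i j
  have hWsymm : ∀ t ∈ Icc 0 T, (W t).IsSymm :=
    isSymm_of_riccati (Matrix.isSymm_mul_transpose_self σ) hA
      (fun t _ => isSymm_driftHessian hb (φ t) (θ t)) hWd
      (by rw [hW.final]; exact isSymm_hessianMat hf _)
  have key := integrable_exp_and_exp_integral_trace_eq hB hT hA hH hWsymm hWd hZ
  rwa [hW.final] at key
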